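/- Let $k$ be a field and let $G$ be a finite simple graph (not necessarily connected) with vertex set $V(G)$ and edge set $E(G)$. The toric ideal of $G$ is the kernel $P_G$ of the $k$-algebra homomorphism $k[x_e : e\in E(G)]\to k[t_v : v\in V(G)]$, $x_{\{u,v\}}\mapsto t_ut_v$, and $G$ is called a complete intersection if the minimal number of generators $\mu(P_G)$ equals the height $\mathrm{ht}(P_G)$. For a closed walk $w=(v_0,v_1,\ldots,v_{2q}=v_0)$ with edges $e_j=\{v_{j-1},v_j\}$ put $B_w=\prod_{l=1}^q x_{e_{2l-1}}-\prod_{l=1}^q x_{e_{2l}}$. A graph with $2r$ distinct vertices $a_1,\ldots,a_r,b_1,\ldots,b_r$ $(r\ge 1)$ is a band (respectively, a Möbius band) if its edges are $\{a_i,a_{i+1}\}$ and $\{b_i,b_{i+1}\}$ for $1\le i<r$, $\{a_j,b_j\}$ for $1\le j\le r$, and $\{a_1,a_r\},\{b_1,b_r\}$ (respectively, $\{a_1,b_r\},\{a_r,b_1\}$). It is odd or even according to the parity of $r$. Let $G$ be $3$-regular. Then: (1) $G$ is a complete intersection if and only if every connected component of $G$ is an odd band or an even Möbius band. (2) If $G$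 is an odd band with vertices $a_1,\ldots,a_r,b_1,\ldots,b_r$ as above, then $\{B_{w_1},\ldots,B_{w_r}\}$ is a minimal set of generators of $P_G$ consisting of $r$ distinct quadrics, where $w_i=(a_i,b_i,b_{i+1},a_{i+1},a_i)$ for $1\le i\le r-1$ and $w_r=(a_1,b_1,b_r,a_r,a_1)$. (3) If $G$ is an even Möbius band with vertices $a_1,\ldots,a_r,b_1,\ldots,b_r$ as above, then $\{B_{w_1},\ldots,B_{w_r}\}$ is a minimal set of generators of $P_G$ consisting of $r$ distinct quadrics, where $w_i=(a_i,b_i,b_{i+1},a_{i+1},a_i)$ for $1\le i\le r-1$ and $w_r=(a_1,b_1,a_r,b_r,a_1)$. (4) If every connected component of $G$ is an odd band or an even Möbius band, then, for any choice of such labellings of the vertices of the components, the union over the components of the sets of quadrics in (2) and (3) is a minimal set of generators of $P_G$. Here a minimal set of generators is one of which no proper subset generates the ideal and which has the least possible number $\mu(P_G)$ of elements. -/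

import Mathlib

namespace ToricGraph

section Toric

/-- The toric ideal of a matrix `A` with entries in `ℕ`: the kernel of the `k`-algebra homomorphism
`k[x_j] → k[t_i]` that sends `x_j` to `t ^ a_j`, where `a_j` is the `j`-th column of `A`. -/
noncomputable def toricIdeal (k : Type*) [Field k] {m n : Type*} [Fintype m] (A : Matrix m n ℕ) :
    Ideal (MvPolynomial n k) :=
  RingHom.ker (MvPolynomial.aeval (R := k)
    (fun j : n => ∏ i : m, (MvPolynomial.X i : MvPolynomial m k) ^ A i j))

/-- The minimal number of generators of `I` equals the height of `I`
(used for ideals of Noetherian rings only). -/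
def IsCompleteIntersection {R : Type*} [CommRing R] (I : Ideal R) : Prop :=
  (Submodule.spanFinrank I : ℕ∞) = I.height

/-- `S` generates `I`, no proper subset of `S` generates `I`, and no generating set of `I` has fewer
elements than `S`. -/
structure IsMinimalGeneratingSet {R : Type*} [CommRing R] (I : Ideal R) (S : Set R) : Prop where
  span_eq : Ideal.span S = I
  irredundant : ∀ T : Set R, T ⊂ S → Ideal.span T ≠ I
  encard_le : ∀ T : Set R, Ideal.span T = I → S.encard ≤ T.encard

end Toric

section Graphs

variable {V : Type*}

open Classical in
/-- The incidence matrix of `G`: rows indexed by the vertices, columns by the edges of `G`. -/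
noncomputable def incidence (G : SimpleGraph V) : Matrix V G.edgeSet ℕ :=
  (G.incMatrix ℕ).submatrix id Subtype.val

/-- The toric ideal `P_G` of the graph `G`, in the polynomial ring with one variable per edge. -/
noncomputable def graphIdeal (k : Type*) [Field k] [Fintype V] (G : SimpleGraph V) :
    Ideal (MvPolynomial G.edgeSet k) :=
  toricIdeal k (incidence G)

/-- The pair (product of the variables of the 1st, 3rd, 5th, … edges of the walk,
product of the variables of its 2nd, 4th, 6th, … edges). -/
noncomputable def walkMonomials (k : Type*) [Field k] {G : SimpleGraph V} :
    {u v : V} → G.Walk u v → MvPolynomial G.edgeSet k × MvPolynomial G.edgeSet k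
  | _, _, .nil => (1, 1)
  | u, _, .cons (v := v) h p =>
      (MvPolynomial.X ⟨s(u, v), h⟩ * (walkMonomials k p).2, (walkMonomials k p).1)

/-- The binomial `B_w` of a walk `w` (of interest when `w` is closed of even length). -/
noncomputable def walkBinomial (k : Type*) [Field k] {G : SimpleGraph V} {u v : V}
    (w : G.Walk u v) : MvPolynomial G.edgeSet k :=
  (walkMonomials k w).1 - (walkMonomials k w).2

/-- The edges `{a_i, a_{i+1}}`, `{b_i, b_{i+1}}` and `{a_j, b_j}` of the chain on the vertices
`a_1, …, a_r, b_1, …, b_r`, where `r = n + 1` and the indices are shifted to `0, …, n`. -/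
def chainEdges {n : ℕ} (a b : Fin (n + 1) → V) : Set (Sym2 V) :=
  {e | (∃ i : Fin n, e = s(a i.castSucc, a i.succ) ∨ e = s(b i.castSucc, b i.succ)) ∨
    ∃ j : Fin (n + 1), e = s(a j, b j)}

/-- `G` is a band with vertices `a_1, …, a_r, b_1, …, b_r` (all distinct), `r = n + 1`. -/
structure IsBand (G : SimpleGraph V) {n : ℕ} (a b : Fin (n + 1) → V) : Prop where
  bijective : Function.Bijective (Sum.elim a b)
  edgeSet_eq : G.edgeSet =
    chainEdges a b ∪ {s(a 0, a (Fin.last n)), s(b 0, b (Fin.last n))}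

/-- `G` is a Möbius band with vertices `a_1, …, a_r, b_1, …, b_r` (all distinct), `r = n + 1`. -/
structure IsMobiusBand (G : SimpleGraph V) {n : ℕ} (a b : Fin (n + 1) → V) : Prop where
  bijective : Function.Bijective (Sum.elim a b)
  edgeSet_eq : G.edgeSet =
    chainEdges a b ∪ {s(a 0, b (Fin.last n)), s(a (Fin.last n), b 0)}

/-- `G` is a band with `r = n + 1` odd. -/
def IsOddBand (G : SimpleGraph V) : Prop :=
  ∃ (n : ℕ) (a b : Fin (n + 1) → V), Odd (n + 1) ∧ IsBand G a b

/-- `G` is a Möbius band with `r = n + 1` even. -/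
def IsEvenMobiusBand (G : SimpleGraph V) : Prop :=
  ∃ (n : ℕ) (a b : Fin (n + 1) → V), Even (n + 1) ∧ IsMobiusBand G a b

/-- The binomials of the closed walks `w_i = (a_i, b_i, b_{i+1}, a_{i+1}, a_i)`, `1 ≤ i < r`, and
`w_r = (a_1, b_1, b_r, a_r, a_1)` of `G`. A walk is given by its list of vertices. -/
def bandQuadrics (k : Type*) [Field k] (G : SimpleGraph V) {n : ℕ} (a b : Fin (n + 1) → V) :
    Set (MvPolynomial G.edgeSet k) :=
  {f | ∃ (u : V) (w : G.Walk u u), f = walkBinomial k w ∧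
    ((∃ i : Fin n, w.support = [a i.castSucc, b i.castSucc, b i.succ, a i.succ, a i.castSucc]) ∨
      w.support = [a 0, b 0, b (Fin.last n), a (Fin.last n), a 0])}

/-- The binomials of the closed walks `w_i = (a_i, b_i, b_{i+1}, a_{i+1}, a_i)`, `1 ≤ i < r`, and
`w_r = (a_1, b_1, a_r, b_r, a_1)` of `G`. A walk is given by its list of vertices. -/
def mobiusQuadrics (k : Type*) [Field k] (G : SimpleGraph V) {n : ℕ} (a b : Fin (n + 1) → V) :
    Set (MvPolynomial G.edgeSet k) :=
  {f | ∃ (u : V) (w : G.Walk u u), f = walkBinomial k w ∧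
    ((∃ i : Fin n, w.support = [a i.castSucc, b i.castSucc, b i.succ, a i.succ, a i.castSucc]) ∨
      w.support = [a 0, b 0, a (Fin.last n), b (Fin.last n), a 0])}

/-- `S` is the set of explicit quadrics of the component `c` of `G` for some way of writing `c` as an
odd band or as an even Möbius band. -/
def IsComponentQuadrics (k : Type*) [Field k] {G : SimpleGraph V} (c : G.ConnectedComponent)
    (S : Set (MvPolynomial G.edgeSet k)) : Prop :=
  ∃ (n : ℕ) (a b : Fin (n + 1) → c),
    (Odd (n + 1) ∧ IsBand c.toSimpleGraph a b ∧
        S = bandQuadrics k G (fun i => (a i : V)) (fun i => (b i : V))) ∨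
      (Even (n + 1) ∧ IsMobiusBand c.toSimpleGraph a b ∧
        S = mobiusQuadrics k G (fun i => (a i : V)) (fun i => (b i : V)))

end Graphs

end ToricGraph

/-!
The height of `P_G` is the rank of the lattice of integral relations between the columns of the
incidence matrix, and for a cubic graph it is at least `|E| - |V| = |V| / 2`, with equality exactly
when no component is bipartite. Suppose that `G` is a complete intersection, and choose binomial
generators, one for each unit of height. The edges avoiding a vertex `v` span a face, so the lattice
of that face is generated by the generators avoiding `v`; as the generators are independent, those
through `v` stay independent after restriction to the edges at `v`, where a relation has only two
degrees of freedom. So at most two generators pass through each vertex, while each passes through at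
least four vertices. The double count is tight: the generators are quadrics of 4-cycles, exactly two
of them pass through each vertex, and no component is bipartite. The edge at `v` shared by its two
4-cycles is a rung of a ladder, and following the other edges until they return closes the ladder up
to a band or a Möbius band, whose parity is the one that is not bipartite.

Conversely, on such ladders the quadrics exchange opposite sides of a square for its rungs, so they
reduce every monomial to one without a pair of opposite sides. In a relation the difference of the
values at opposite sides changes sign at each step along the ladder, and vanishes by parity; hence a
reduced binomial of `P_G` is zero. The quadrics are `|V| / 2` in number, which is at most the
height, and Krull's height theorem makes them a minimal set of generators.
-/

namespace ToricGraph

theorem finrank_range_add_finrank_ker.{u} {R N : Type*} {M : Type u} [Ring R]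
    [StrongRankCondition R] [HasRankNullity.{u} R] [AddCommGroup M] [AddCommGroup N] [Module R M]
    [Module R N] [Module.Finite R M] (f : M →ₗ[R] N) :
    Module.finrank R (LinearMap.range f) + Module.finrank R (LinearMap.ker f) =
      Module.finrank R M := by
  rw [← f.quotKerEquivRange.finrank_eq, Submodule.finrank_quotient_add_finrank]

section Binomials

open MvPolynomial

variable {n : Type*}

/-- The integral vector `α - β` of a pair of exponents. -/
def expDiff (α β : n →₀ ℕ) : n → ℤ := fun j => (α j : ℤ) - β j

theorem expDiff_add_add (α β α' β' : n →₀ ℕ) :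
    expDiff (α + α') (β + β') = expDiff α β + expDiff α' β' := by
  ext j
  simp only [expDiff, Finsupp.add_apply, Pi.add_apply]
  push_cast
  ring

theorem neg_expDiff (α β : n →₀ ℕ) : -expDiff α β = expDiff β α := by
  ext j; simp [expDiff]

theorem expDiff_self (α : n →₀ ℕ) : expDiff α α = 0 := by
  ext j; simp [expDiff]

theorem expDiff_zero_right (α : n →₀ ℕ) : expDiff α 0 = fun j => (α j : ℤ) := by
  ext j; simp [expDiff]

theorem expDiff_zero_sub_expDiff_zero (α β : n →₀ ℕ) :
    expDiff α 0 - expDiff β 0 = expDiff α β := by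
  ext j; simp [expDiff]

theorem expDiff_eq_expDiff_iff {α β α' β' : n →₀ ℕ} :
    expDiff α β = expDiff α' β' ↔ α + β' = α' + β := by
  simp only [expDiff, funext_iff, Finsupp.ext_iff, Finsupp.add_apply]
  exact forall_congr' fun j => by omega

theorem exists_expDiff_eq [Finite n] (u : n → ℤ) :
    ∃ α β : n →₀ ℕ, expDiff α β = u ∧ ∀ j, u j = 0 → α j = 0 ∧ β j = 0 := by
  refine ⟨Finsupp.equivFunOnFinite.symm fun j => (u j).toNat,
    Finsupp.equivFunOnFinite.symm fun j => (-u j).toNat, ?_, fun j hj => by simp [hj]⟩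
  ext j; simp [expDiff]

variable (k : Type*) [CommRing k]

/-- The binomial `x ^ α - x ^ β`. -/
noncomputable def binomial (α β : n →₀ ℕ) : MvPolynomial n k := monomial α 1 - monomial β 1

variable {k}

theorem binomial_self (α : n →₀ ℕ) : binomial k α α = 0 := sub_self _

theorem neg_binomial (α β : n →₀ ℕ) : -binomial k α β = binomial k β α := neg_sub _ _

theorem monomial_mul_binomial (γ α β : n →₀ ℕ) :
    monomial γ 1 * binomial k α β = binomial k (γ + α) (γ + β) := by
  simp only [binomial, mul_sub, monomial_mul, mul_one]

theorem binomial_add_add (α β α' β' : n →₀ ℕ) :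
    binomial k (α + α') (β + β') =
      monomial α 1 * binomial k α' β' + monomial β' 1 * binomial k α β := by
  rw [monomial_mul_binomial, monomial_mul_binomial, add_comm β' α, add_comm β' β]
  simp only [binomial, sub_add_sub_cancel]

/-- The lattice of the vectors `α - β` of the binomials `x ^ α - x ^ β` in an ideal. -/
def binomialLattice (Q : Ideal (MvPolynomial n k)) : AddSubgroup (n → ℤ) where
  carrier := {u | ∃ α β, expDiff α β = u ∧ binomial k α β ∈ Q}
  zero_mem' := ⟨0, 0, expDiff_self 0, by simp [binomial_self]⟩
  add_mem' := by
    rintro _ _ ⟨α, β, rfl, h⟩ ⟨α', β', rfl, h'⟩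
    refine ⟨α + α', β + β', expDiff_add_add α β α' β', ?_⟩
    rw [binomial_add_add]
    exact add_mem (Q.mul_mem_left _ h') (Q.mul_mem_left _ h)
  neg_mem' := by
    rintro _ ⟨α, β, rfl, h⟩
    exact ⟨β, α, (neg_expDiff α β).symm, neg_binomial (k := k) α β ▸ neg_mem h⟩

/-- An exponent pair is determined by its difference up to a common monomial factor, and a prime
ideal without monomials lets that factor be cancelled. -/
theorem binomial_mem_of_expDiff_mem_binomialLattice {Q : Ideal (MvPolynomial n k)} [hQ : Q.IsPrime]
    (hmon : ∀ γ : n →₀ ℕ, monomial γ 1 ∉ Q) {α β : n →₀ ℕ}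
    (h : expDiff α β ∈ binomialLattice Q) : binomial k α β ∈ Q := by
  obtain ⟨α', β', hdiff, hmem⟩ := h
  have hfactor : monomial β' 1 * binomial k α β = monomial β 1 * binomial k α' β' := by
    rw [monomial_mul_binomial, monomial_mul_binomial, add_comm β' α, add_comm β α',
      expDiff_eq_expDiff_iff.1 hdiff, add_comm β' β]
  exact (hQ.mem_or_mem (hfactor ▸ Q.mul_mem_left _ hmem)).resolve_left (hmon β')

end Binomials

section ToricIdeals

open MvPolynomial Matrix

variable {k : Type*} [Field k] {m n : Type*}

instance toricIdeal_isPrime [Fintype m] (A : Matrix m n ℕ) : (toricIdeal k A).IsPrime :=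
  RingHom.ker_isPrime _

theorem monomial_notMem_toricIdeal [Fintype m] (A : Matrix m n ℕ) (α : n →₀ ℕ) :
    (monomial α 1 : MvPolynomial n k) ∉ toricIdeal k A := by
  rw [toricIdeal, RingHom.mem_ker]
  erw [aeval_monomial]
  rw [map_one, one_mul]
  exact Finset.prod_ne_zero_iff.2 fun j _ => pow_ne_zero _
    (Finset.prod_ne_zero_iff.2 fun i _ => pow_ne_zero _ (X_ne_zero i))

variable [Fintype n]

/-- The lattice of integral relations between the columns of `A`. -/
def relationLattice (A : Matrix m n ℕ) : Submodule ℤ (n → ℤ) :=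
  LinearMap.ker (A.map (Nat.cast : ℕ → ℤ)).mulVecLin

theorem mem_relationLattice {A : Matrix m n ℕ} {u : n → ℤ} :
    u ∈ relationLattice A ↔ ∀ i, ∑ j, (A i j : ℤ) * u j = 0 := by
  simp only [relationLattice, LinearMap.mem_ker, mulVecLin_apply, funext_iff]
  rfl

theorem expDiff_mem_relationLattice {A : Matrix m n ℕ} {α β : n →₀ ℕ} :
    expDiff α β ∈ relationLattice A ↔ A *ᵥ α = A *ᵥ β := by
  simp only [mem_relationLattice, funext_iff, mulVec, dotProduct, expDiff, mul_sub,
    Finset.sum_sub_distrib, sub_eq_zero]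
  exact forall_congr' fun i => by norm_cast

/-- The matrix `A` with one more row, the `e`-th unit vector: its lattice is the sublattice of the
relations that vanish at `e`. -/
def addUnitRow [DecidableEq n] (A : Matrix m n ℕ) (e : n) : Matrix (Option m) n ℕ :=
  Matrix.of fun i j => i.elim (if j = e then 1 else 0) fun i => A i j

theorem mem_relationLattice_addUnitRow [DecidableEq n] {A : Matrix m n ℕ} {e : n} {u : n → ℤ} :
    u ∈ relationLattice (addUnitRow A e) ↔ u ∈ relationLattice A ∧ u e = 0 := by
  simp [mem_relationLattice, Option.forall, addUnitRow, and_comm]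

theorem finrank_relationLattice_le_addUnitRow [DecidableEq n] (A : Matrix m n ℕ) (e : n) :
    Module.finrank ℤ (relationLattice A) ≤
      Module.finrank ℤ (relationLattice (addUnitRow A e)) + 1 := by
  let coord : relationLattice A →ₗ[ℤ] ℤ := (LinearMap.proj e).comp (relationLattice A).subtype
  have hker : relationLattice (addUnitRow A e) =
      (LinearMap.ker coord).map (relationLattice A).subtype := by
    ext u
    rw [mem_relationLattice_addUnitRow, Submodule.mem_map]
    exact ⟨fun ⟨hu, hue⟩ => ⟨⟨u, hu⟩, hue, rfl⟩, by rintro ⟨v, hv, rfl⟩; exact ⟨v.2, hv⟩⟩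
  have hrange : Module.finrank ℤ (LinearMap.range coord) ≤ 1 := by
    simpa using Submodule.finrank_le (LinearMap.range coord)
  have hrank := finrank_range_add_finrank_ker coord
  rw [hker, (Submodule.equivMapOfInjective _ (relationLattice A).injective_subtype
    (LinearMap.ker coord)).symm.finrank_eq]
  omega

variable [Fintype m]

theorem aeval_monomial_eq_monomial_mulVec (A : Matrix m n ℕ) (α : n →₀ ℕ) (c : k) :
    aeval (R := k) (fun j => ∏ i, (X i : MvPolynomial m k) ^ A i j) (monomial α c) =
      monomial (Finsupp.equivFunOnFinite.symm (A *ᵥ α)) c := by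
  rw [aeval_monomial, Finsupp.prod_fintype _ _ fun _ => pow_zero _, monomial_eq,
    Finsupp.prod_fintype _ _ fun _ => pow_zero _, algebraMap_eq]
  simp_rw [← Finset.prod_pow]
  rw [Finset.prod_comm]
  simp_rw [← pow_mul, Finset.prod_pow_eq_pow_sum]
  rfl

theorem binomial_mem_toricIdeal {A : Matrix m n ℕ} {α β : n →₀ ℕ} :
    binomial k α β ∈ toricIdeal k A ↔ A *ᵥ α = A *ᵥ β := by
  rw [toricIdeal, RingHom.mem_ker, binomial, map_sub, sub_eq_zero]
  erw [aeval_monomial_eq_monomial_mulVec, aeval_monomial_eq_monomial_mulVec]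
  rw [monomial_left_inj one_ne_zero, EmbeddingLike.apply_eq_iff_eq]

/-- The binomials of the toric ideal of `A`. -/
def toricBinomials (k : Type*) [Field k] (A : Matrix m n ℕ) : Set (MvPolynomial n k) :=
  {f | ∃ α β : n →₀ ℕ, A *ᵥ α = A *ᵥ β ∧ f = binomial k α β}

theorem span_toricBinomials (A : Matrix m n ℕ) :
    Ideal.span (toricBinomials k A) = toricIdeal k A := by
  refine le_antisymm (Ideal.span_le.2 ?_) fun f hf => ?_
  · rintro _ ⟨α, β, h, rfl⟩
    exact binomial_mem_toricIdeal.2 h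
  -- Modulo the binomials a monomial depends only on its image, so the quotient map factors
  -- linearly through the parametrization.
  let π := Ideal.Quotient.mkₐ k (Ideal.span (toricBinomials k A))
  let φ := aeval (R := k) (fun j => ∏ i, (X i : MvPolynomial m k) ^ A i j)
  let image : (n →₀ ℕ) → (m →₀ ℕ) := fun α => Finsupp.equivFunOnFinite.symm (A *ᵥ α)
  let lift : MvPolynomial m k →ₗ[k] MvPolynomial n k ⧸ Ideal.span (toricBinomials k A) :=
    (basisMonomials m k).constr k fun d => π (monomial (Function.invFun image d) 1)
  have hfactor : π.toLinearMap = lift ∘ₗ φ.toLinearMap := by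
    refine (basisMonomials n k).ext fun α => ?_
    have himage : image α = image (Function.invFun image (image α)) :=
      (Function.invFun_eq (f := image) ⟨α, rfl⟩).symm
    have hφ : φ (monomial α 1) = basisMonomials m k (image α) :=
      aeval_monomial_eq_monomial_mulVec A α 1
    rw [LinearMap.comp_apply, coe_basisMonomials, AlgHom.toLinearMap_apply,
      AlgHom.toLinearMap_apply, hφ, Module.Basis.constr_basis]
    exact Ideal.Quotient.eq.2 (Ideal.subset_span
      ⟨_, _, Finsupp.equivFunOnFinite.symm.injective himage, rfl⟩)
  have hπf : π f = lift (φ f) := LinearMap.congr_fun hfactor f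
  rwa [show φ f = 0 from hf, map_zero, Ideal.Quotient.mkₐ_eq_mk, Ideal.Quotient.eq_zero_iff_mem]
    at hπf

theorem toricIdeal_mono {m' : Type*} [Fintype m'] {A : Matrix m n ℕ} {B : Matrix m' n ℕ}
    (h : relationLattice B ≤ relationLattice A) : toricIdeal k B ≤ toricIdeal k A := by
  rw [← span_toricBinomials B, Ideal.span_le]
  rintro _ ⟨α, β, hαβ, rfl⟩
  exact binomial_mem_toricIdeal.2
    (expDiff_mem_relationLattice.1 (h (expDiff_mem_relationLattice.2 hαβ)))

theorem toricIdeal_mem_minimalPrimes_span {ι : Type*} {A : Matrix m n ℕ} {α β : ι → n →₀ ℕ}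
    (h : Submodule.span ℤ (Set.range fun i => expDiff (α i) (β i)) = relationLattice A) :
    toricIdeal k A ∈ (Ideal.span (Set.range fun i => binomial k (α i) (β i))).minimalPrimes := by
  refine ⟨⟨inferInstance, Ideal.span_le.2 ?_⟩, fun Q ⟨hQ, hle⟩ hQA => ?_⟩
  · rintro _ ⟨i, rfl⟩
    refine binomial_mem_toricIdeal.2 (expDiff_mem_relationLattice.1 ?_)
    exact h ▸ Submodule.subset_span ⟨i, rfl⟩
  have hlattice : relationLattice A ≤ (binomialLattice Q).toIntSubmodule := by
    rw [← h, Submodule.span_le]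
    rintro _ ⟨i, rfl⟩
    exact ⟨α i, β i, rfl, hle (Ideal.subset_span ⟨i, rfl⟩)⟩
  rw [← span_toricBinomials, Ideal.span_le]
  rintro _ ⟨γ, δ, hγδ, rfl⟩
  exact binomial_mem_of_expDiff_mem_binomialLattice
    (fun ε hε => monomial_notMem_toricIdeal A ε (hQA hε))
    (hlattice (expDiff_mem_relationLattice.2 hγδ))

theorem height_toricIdeal_le (A : Matrix m n ℕ) :
    (toricIdeal k A).height ≤ Module.finrank ℤ (relationLattice A) := by
  let b := Module.finBasis ℤ (relationLattice A)
  choose α β hαβ _ using fun i => exists_expDiff_eq (b i : n → ℤ)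
  have hspan : Submodule.span ℤ (Set.range fun i => expDiff (α i) (β i)) = relationLattice A := by
    simp_rw [hαβ]
    change Submodule.span ℤ (Set.range ((relationLattice A).subtype ∘ b)) = _
    rw [Set.range_comp, Submodule.span_image, b.span_eq, Submodule.map_subtype_top]
  refine (Ideal.height_le_card_of_mem_minimalPrimes_span (Set.finite_range _)
    (toricIdeal_mem_minimalPrimes_span hspan)).trans ?_
  rw [← Nat.card_coe_set_eq]
  exact_mod_cast (Finite.card_range_le _).trans (Nat.card_fin _).le

theorem toricIdeal_addUnitRow_lt [DecidableEq n] {A : Matrix m n ℕ} {u : n → ℤ}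
    (hu : u ∈ relationLattice A) {e : n} (hue : u e ≠ 0) :
    toricIdeal k (addUnitRow A e) < toricIdeal k A := by
  refine lt_of_le_of_ne (toricIdeal_mono fun w hw => (mem_relationLattice_addUnitRow.1 hw).1)
    fun h => hue ?_
  obtain ⟨α, β, rfl, -⟩ := exists_expDiff_eq u
  have hmem : binomial k α β ∈ toricIdeal k A :=
    binomial_mem_toricIdeal.2 (expDiff_mem_relationLattice.1 hu)
  rw [← h, binomial_mem_toricIdeal, ← expDiff_mem_relationLattice] at hmem
  exact (mem_relationLattice_addUnitRow.1 hmem).2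

theorem le_height_toricIdeal_of_le_finrank (d : ℕ) :
    ∀ {m : Type*} [Fintype m] (A : Matrix m n ℕ), d ≤ Module.finrank ℤ (relationLattice A) →
      (d : ℕ∞) ≤ (toricIdeal k A).height := by
  classical
  induction d with
  | zero => simp
  | succ d ih =>
    intro m _ A hd
    obtain ⟨u, hu, hu0⟩ := Submodule.exists_mem_ne_zero_of_ne_bot
      (show relationLattice A ≠ ⊥ from
      fun h => by rw [h, finrank_bot] at hd; omega)
    obtain ⟨e, hue⟩ := Function.ne_iff.1 hu0
    have hrank := finrank_relationLattice_le_addUnitRow A e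
    calc ((d + 1 : ℕ) : ℕ∞) = (d : ℕ∞) + 1 := by push_cast; rfl
      _ ≤ (toricIdeal k (addUnitRow A e)).height + 1 := by gcongr; exact ih _ (by omega)
      _ ≤ (toricIdeal k A).height :=
        Ideal.height_add_one_le_of_lt_of_isPrime (toricIdeal_addUnitRow_lt hu hue)

theorem height_toricIdeal (A : Matrix m n ℕ) :
    (toricIdeal k A).height = Module.finrank ℤ (relationLattice A) :=
  le_antisymm (height_toricIdeal_le A) (le_height_toricIdeal_of_le_finrank _ A le_rfl)

end ToricIdeals

section HomogeneousGenerators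

open MvPolynomial

attribute [local instance] MvPolynomial.gradedAlgebra

theorem mem_idealOfVars_iff {σ R : Type*} [CommRing R] {f : MvPolynomial σ R} :
    f ∈ idealOfVars σ R ↔ coeff 0 f = 0 := by
  rw [← pow_one (idealOfVars σ R), mem_pow_idealOfVars_iff']
  simp only [Nat.lt_one_iff, Finsupp.degree_eq_zero_iff, forall_eq]

theorem homogeneousComponent_mul_of_isHomogeneous {σ R : Type*} [CommRing R]
    (g : MvPolynomial σ R) {f : MvPolynomial σ R} {d : ℕ} (hf : f.IsHomogeneous d) :
    homogeneousComponent d (g * f) = C (coeff 0 g) * f := by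
  have hrest : (g - C (coeff 0 g)) * f ∈ idealOfVars σ R ^ (d + 1) := by
    rw [pow_succ']
    refine Ideal.mul_mem_mul (mem_idealOfVars_iff.2 (by simp))
      ((mem_pow_idealOfVars_iff d f).2 fun x hx => (hf.degree_eq_sum_deg_support hx).le)
  rw [← sub_add_cancel g (C (coeff 0 g)), add_mul, map_add, homogeneousComponent_C_mul,
    homogeneousComponent_of_mem hf, if_pos rfl, sub_add_cancel, add_eq_right]
  exact homogeneousComponent_eq_zero' _ _ fun x hx =>
    (Nat.lt_of_succ_le ((mem_pow_idealOfVars_iff _ _).1 hrest x hx)).ne'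

/-- Nakayama's lemma yields a multiplier with constant term `1`, which on a homogeneous element can
be removed by passing to homogeneous components. -/
theorem le_of_le_sup_idealOfVars_mul {σ R : Type*} [CommRing R] {I J : Ideal (MvPolynomial σ R)}
    (hIfg : I.FG) (hI : I.IsHomogeneous (homogeneousSubmodule σ R))
    (hJ : J.IsHomogeneous (homogeneousSubmodule σ R)) (h : I ≤ J ⊔ idealOfVars σ R * I) :
    I ≤ J := by
  obtain ⟨r, hr, hrI⟩ := Submodule.exists_sub_one_mem_and_smul_le_of_fg_of_le_sup hIfg le_rfl h
  have hr0 : coeff 0 r = 1 := by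
    simpa [sub_eq_zero] using mem_idealOfVars_iff.1 hr
  have hhom : ∀ {d : ℕ} {f}, f ∈ I → f.IsHomogeneous d → f ∈ J := by
    intro d f hf hd
    have hmem := homogeneousComponent_mem_of_mem hJ
      (hrI (Submodule.smul_mem_pointwise_smul f r I hf)) d
    rwa [smul_eq_mul, homogeneousComponent_mul_of_isHomogeneous r hd, hr0, C_1, one_mul] at hmem
  intro f hf
  rw [← sum_homogeneousComponent f]
  exact sum_mem fun d _ =>
    hhom (homogeneousComponent_mem_of_mem hI hf d) (homogeneousComponent_isHomogeneous d f)

variable {k σ : Type*} [Field k]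

theorem span_image_mkₐ_idealOfVars_mul (W : Set (MvPolynomial σ k)) :
    Submodule.span k (Ideal.Quotient.mkₐ k (idealOfVars σ k * Ideal.span W) '' W) =
      ((Ideal.span W).restrictScalars k).map
        (Ideal.Quotient.mkₐ k (idealOfVars σ k * Ideal.span W)).toLinearMap := by
  set π := Ideal.Quotient.mkₐ k (idealOfVars σ k * Ideal.span W)
  refine le_antisymm (Submodule.span_le.2 ?_) ?_
  · rintro _ ⟨f, hf, rfl⟩
    exact ⟨f, Ideal.subset_span hf, rfl⟩
  rintro _ ⟨f, hf, rfl⟩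
  change π f ∈ _
  replace hf : f ∈ Ideal.span W := hf
  induction hf using Submodule.span_induction with
  | mem f hf => exact Submodule.subset_span ⟨f, hf, rfl⟩
  | zero => rw [map_zero]; exact zero_mem _
  | add f g _ _ hf hg => rw [map_add]; exact add_mem hf hg
  | smul g f hf hπf =>
    have hconst : π (g • f) = coeff 0 g • π f := by
      rw [← map_smul, smul_eq_mul, smul_eq_C_mul]
      refine Ideal.Quotient.eq.2 ?_
      rw [← sub_mul]
      exact Ideal.mul_mem_mul (mem_idealOfVars_iff.2 (by simp)) hf
    rw [hconst]
    exact Submodule.smul_mem _ _ hπf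

theorem finrank_map_mkₐ_idealOfVars_mul_le {I : Ideal (MvPolynomial σ k)} (hI : I.FG) :
    Module.Finite k ((I.restrictScalars k).map
        (Ideal.Quotient.mkₐ k (idealOfVars σ k * I)).toLinearMap) ∧
      Module.finrank k ((I.restrictScalars k).map
        (Ideal.Quotient.mkₐ k (idealOfVars σ k * I)).toLinearMap) ≤ Submodule.spanFinrank I := by
  classical
  obtain ⟨S, hScard, hS⟩ := Submodule.FG.exists_span_finset_card_eq_spanFinrank hI
  have hspan := span_image_mkₐ_idealOfVars_mul (k := k) (S : Set (MvPolynomial σ k))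
  rw [show Ideal.span (S : Set (MvPolynomial σ k)) = I from hS, ← Finset.coe_image] at hspan
  rw [← hspan, ← hScard]
  exact ⟨inferInstance, (finrank_span_finset_le_card _).trans Finset.card_image_le⟩

/-- Lift a `k`-basis of `I / 𝔪 I`, where `𝔪` is the ideal of the variables. -/
theorem exists_subset_span_eq_of_isHomogeneous [Finite σ] {U : Set (MvPolynomial σ k)}
    (hU : ∀ f ∈ U, ∃ d, f.IsHomogeneous d) :
    ∃ T ⊆ U, T.Finite ∧ T.ncard ≤ Submodule.spanFinrank (Ideal.span U) ∧
      Ideal.span T = Ideal.span U ∧ ∀ f ∈ T, f ∉ idealOfVars σ k * Ideal.span U := by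
  set π := Ideal.Quotient.mkₐ k (idealOfVars σ k * Ideal.span U)
  obtain ⟨hfinite, hrank⟩ :=
    finrank_map_mkₐ_idealOfVars_mul_le (IsNoetherian.noetherian (Ideal.span U))
  rw [← span_image_mkₐ_idealOfVars_mul] at hfinite hrank
  obtain ⟨T, hTU, -, hspan, hind⟩ :=
    exists_linearIndepOn_extension (v := π) (linearIndepOn_empty k π) (Set.empty_subset U)
  have hind' : LinearIndependent k fun f : ↥T => (⟨π f, Submodule.subset_span
      (Set.mem_image_of_mem π (hTU f.2))⟩ : Submodule.span k (π '' U)) :=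
    LinearIndependent.of_comp (Submodule.span k (π '' U)).subtype hind
  have hTfin : Finite T := hind'.finite
  refine ⟨T, hTU, hTfin, ?_, ?_, fun f hf hmem => ?_⟩
  · have := Fintype.ofFinite T
    rw [← Nat.card_coe_set_eq, Nat.card_eq_fintype_card]
    exact hind'.fintype_card_le_finrank.trans hrank
  · refine le_antisymm (Ideal.span_mono hTU) (le_of_le_sup_idealOfVars_mul
      (IsNoetherian.noetherian _) (Ideal.homogeneous_span _ _ hU)
      (Ideal.homogeneous_span _ _ fun f hf => hU f (hTU hf)) (Ideal.span_le.2 fun f hf => ?_))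
    obtain ⟨g, hg, hgf⟩ : π f ∈ (Submodule.span k T).map π.toLinearMap := by
      rw [Submodule.map_span]
      exact hspan ⟨f, hf, rfl⟩
    rw [← add_sub_cancel g f]
    exact Submodule.add_mem_sup (Submodule.span_le_restrictScalars k (MvPolynomial σ k) _ hg)
      (Ideal.Quotient.eq.1 hgf.symm)
  · exact hind.ne_zero hf (Ideal.Quotient.eq_zero_iff_mem.2 hmem)

end HomogeneousGenerators

section MinimalBinomials

open MvPolynomial Matrix

variable {k : Type*} [Field k] {m n : Type*} [Fintype m] [Fintype n]

/-- A binomial of the toric ideal of `A` that lies outside `𝔪 P`, where `P` is the ideal and `𝔪` is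
the ideal of the variables: one that can belong to a minimal system of homogeneous generators. -/
structure IsMinimalBinomial (k : Type*) [Field k] (A : Matrix m n ℕ) (α β : n →₀ ℕ) : Prop where
  mulVec_eq : A *ᵥ α = A *ᵥ β
  notMem : binomial k α β ∉ idealOfVars n k * toricIdeal k A

theorem exists_minimal_binomial_generators {A : Matrix m n ℕ}
    (hA : ∀ α β : n →₀ ℕ, A *ᵥ α = A *ᵥ β → α.degree = β.degree) :
    ∃ (s : ℕ) (α β : Fin s → n →₀ ℕ), s ≤ Submodule.spanFinrank (toricIdeal k A) ∧
      (∀ i, IsMinimalBinomial k A (α i) (β i)) ∧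
      Ideal.span (Set.range fun i => binomial k (α i) (β i)) = toricIdeal k A := by
  have hhom : ∀ f ∈ toricBinomials k A, ∃ d, f.IsHomogeneous d := by
    rintro _ ⟨α, β, h, rfl⟩
    exact ⟨α.degree, (isHomogeneous_monomial 1 rfl).sub (isHomogeneous_monomial 1 (hA α β h).symm)⟩
  obtain ⟨T, hT, hTfin, hTcard, hTspan, hTmin⟩ := exists_subset_span_eq_of_isHomogeneous hhom
  rw [span_toricBinomials] at hTcard hTspan hTmin
  have : Finite T := hTfin
  let e : Fin (Nat.card T) ≃ T := (Finite.equivFin T).symm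
  choose α β hαβ he using fun i => hT (e i).2
  refine ⟨Nat.card T, α, β, hTcard, fun i => ⟨hαβ i, he i ▸ hTmin _ (e i).2⟩, ?_⟩
  simp_rw [← he]
  change Ideal.span (Set.range (Subtype.val ∘ e)) = _
  rw [e.surjective.range_comp, Subtype.range_coe, hTspan]

/-- Dividing out the smaller binomial, the two correction terms of `binomial_add_add` lie in `𝔪 P`
unless the quotient monomials are trivial. -/
theorem IsMinimalBinomial.eq_of_le {A : Matrix m n ℕ}
    (hA : ∀ α β : n →₀ ℕ, A *ᵥ α = A *ᵥ β → α.degree = β.degree) {α β γ δ : n →₀ ℕ}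
    (hmin : IsMinimalBinomial k A α β) (hγδ : A *ᵥ γ = A *ᵥ δ) (hγ : γ ≤ α) (hδ : δ ≤ β)
    (hδ0 : δ ≠ 0) : α = γ ∧ β = δ := by
  classical
  have monomial_mem : ∀ {ε : n →₀ ℕ}, ε ≠ 0 → (monomial ε 1 : MvPolynomial n k) ∈ idealOfVars n k :=
    fun hε => mem_idealOfVars_iff.2 ((coeff_monomial _ _ _).trans (if_neg hε))
  obtain ⟨α, rfl⟩ := exists_add_of_le hγ
  obtain ⟨β, rfl⟩ := exists_add_of_le hδ
  rw [add_comm γ, add_comm δ] at hmin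
  have hαβ : A *ᵥ α = A *ᵥ β := by
    rw [← expDiff_mem_relationLattice] at hγδ ⊢
    have hsum := expDiff_mem_relationLattice.2 hmin.mulVec_eq
    rwa [expDiff_add_add, Submodule.add_mem_iff_left _ hγδ] at hsum
  have hα : α = 0 := by
    by_contra hα0
    refine hmin.notMem ?_
    rw [binomial_add_add]
    exact add_mem (Ideal.mul_mem_mul (monomial_mem hα0) (binomial_mem_toricIdeal.2 hγδ))
      (Ideal.mul_mem_mul (monomial_mem hδ0) (binomial_mem_toricIdeal.2 hαβ))
  have hβ : β = 0 := by
    rw [← Finsupp.degree_eq_zero_iff, ← hA α β hαβ, hα, map_zero]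
  simp only [hα, hβ, add_zero, and_self]

theorem IsMinimalBinomial.ne {A : Matrix m n ℕ} {α β : n →₀ ℕ}
    (hmin : IsMinimalBinomial k A α β) : α ≠ β := by
  rintro rfl
  refine hmin.notMem ?_
  rw [binomial_self]
  exact zero_mem _

end MinimalBinomials

section Faces

open MvPolynomial Matrix

variable {k n : Type*} [Field k]

open Classical in
/-- The map to the group algebra of `ℤⁿ / N` that kills the variables of `Z` and sends each other
variable to the class of its unit vector. -/
noncomputable def faceMap (k : Type*) [Field k] (N : Submodule ℤ (n → ℤ)) (Z : Set n) :
    MvPolynomial n k →ₐ[k] AddMonoidAlgebra k ((n → ℤ) ⧸ N) :=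
  aeval fun j => if j ∈ Z then 0 else AddMonoidAlgebra.single (N.mkQ (Pi.single j 1)) 1

theorem faceMap_monomial_eq_zero (N : Submodule ℤ (n → ℤ)) {Z : Set n} {γ : n →₀ ℕ}
    (h : ∃ j ∈ Z, γ j ≠ 0) : faceMap k N Z (monomial γ 1) = 0 := by
  obtain ⟨j, hj, hγ⟩ := h
  rw [faceMap, aeval_monomial, Finsupp.prod, Finset.prod_eq_zero (Finsupp.mem_support_iff.2 hγ)]
  · exact mul_zero _
  · rw [if_pos hj, zero_pow hγ]

theorem faceMap_monomial_eq_single [Finite n] (N : Submodule ℤ (n → ℤ)) {Z : Set n} {γ : n →₀ ℕ}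
    (h : ∀ j ∈ Z, γ j = 0) :
    faceMap k N Z (monomial γ 1) = AddMonoidAlgebra.single (N.mkQ (expDiff γ 0)) 1 := by
  classical
  have := Fintype.ofFinite n
  have hfactor : ∀ j, (if j ∈ Z then (0 : AddMonoidAlgebra k ((n → ℤ) ⧸ N)) else
      AddMonoidAlgebra.single (N.mkQ (Pi.single j 1)) 1) ^ γ j =
      AddMonoidAlgebra.of k _ (Multiplicative.ofAdd (N.mkQ (Pi.single j (γ j : ℤ)))) := by
    intro j
    by_cases hj : j ∈ Z
    · rw [h j hj]
      simp [AddMonoidAlgebra.one_def]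
    · rw [if_neg hj, AddMonoidAlgebra.single_pow, one_pow, AddMonoidAlgebra.of_apply, toAdd_ofAdd,
        ← map_nsmul, ← Pi.single_smul, nsmul_one]
  rw [faceMap, aeval_monomial, map_one, one_mul, Finsupp.prod_fintype _ _ fun _ => pow_zero _]
  simp_rw [hfactor]
  rw [← map_prod, ← ofAdd_sum, ← map_sum, AddMonoidAlgebra.of_apply, toAdd_ofAdd,
    Finset.univ_sum_single fun j => (γ j : ℤ)]
  rw [expDiff_zero_right]

variable [Fintype n] {m ι : Type*} [Fintype m]

/-- The variables outside `Z` span a face when every generator meets `Z` in both monomials or in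
none: `faceMap` then kills the ideal, and it detects the lattice of the remaining generators. -/
theorem mem_span_expDiff_of_vanishing {A : Matrix m n ℕ} {α β : ι → n →₀ ℕ}
    (hspan : Ideal.span (Set.range fun i => binomial k (α i) (β i)) = toricIdeal k A)
    (Z : Set n) (hZ : ∀ i, (∃ j ∈ Z, α i j ≠ 0) ↔ ∃ j ∈ Z, β i j ≠ 0)
    {u : n → ℤ} (hu : u ∈ relationLattice A) (huZ : ∀ j ∈ Z, u j = 0) :
    u ∈ Submodule.span ℤ ((fun i => expDiff (α i) (β i)) '' {i | ∀ j ∈ Z, α i j = 0}) := by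
  set N := Submodule.span ℤ ((fun i => expDiff (α i) (β i)) '' {i | ∀ j ∈ Z, α i j = 0})
  have hker : toricIdeal k A ≤ RingHom.ker (faceMap k N Z) := by
    rw [← hspan, Ideal.span_le]
    rintro _ ⟨i, rfl⟩
    change faceMap k N Z (binomial k (α i) (β i)) = 0
    rw [binomial, map_sub, sub_eq_zero]
    by_cases h : ∃ j ∈ Z, α i j ≠ 0
    · rw [faceMap_monomial_eq_zero N h, faceMap_monomial_eq_zero N ((hZ i).1 h)]
    · have h' := mt (hZ i).2 h
      push Not at h h'
      rw [faceMap_monomial_eq_single N h, faceMap_monomial_eq_single N h']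
      congr 1
      refine (Submodule.Quotient.eq N).2 ?_
      rw [expDiff_zero_sub_expDiff_zero]
      exact Submodule.subset_span ⟨i, h, rfl⟩
  obtain ⟨γ, δ, rfl, hγδ⟩ := exists_expDiff_eq u
  have hmem := hker (binomial_mem_toricIdeal.2 (expDiff_mem_relationLattice.1 hu))
  rw [RingHom.mem_ker, binomial, map_sub, sub_eq_zero,
    faceMap_monomial_eq_single N fun j hj => (hγδ j (huZ j hj)).1,
    faceMap_monomial_eq_single N fun j hj => (hγδ j (huZ j hj)).2,
    AddMonoidAlgebra.single_left_inj one_ne_zero] at hmem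
  rw [← expDiff_zero_sub_expDiff_zero]
  exact (Submodule.Quotient.eq N).1 hmem

theorem span_range_expDiff_eq_relationLattice {A : Matrix m n ℕ} {α β : ι → n →₀ ℕ}
    (hspan : Ideal.span (Set.range fun i => binomial k (α i) (β i)) = toricIdeal k A) :
    Submodule.span ℤ (Set.range fun i => expDiff (α i) (β i)) = relationLattice A := by
  refine le_antisymm (Submodule.span_le.2 ?_) fun u hu => ?_
  · rintro _ ⟨i, rfl⟩
    refine expDiff_mem_relationLattice.2 (binomial_mem_toricIdeal (k := k).1 ?_)
    exact hspan ▸ Ideal.subset_span ⟨i, rfl⟩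
  · simpa using mem_span_expDiff_of_vanishing hspan ∅ (by simp) hu (by simp)

omit [Fintype n] in
theorem eq_zero_of_mem_span_expDiff_of_vanishing [Finite n] {A : Matrix m n ℕ} {α β : ι → n →₀ ℕ}
    (hspan : Ideal.span (Set.range fun i => binomial k (α i) (β i)) = toricIdeal k A)
    (hind : LinearIndependent ℤ fun i => expDiff (α i) (β i))
    (Z : Set n) (hZ : ∀ i, (∃ j ∈ Z, α i j ≠ 0) ↔ ∃ j ∈ Z, β i j ≠ 0) {u : n → ℤ}
    (hu : u ∈ Submodule.span ℤ ((fun i => expDiff (α i) (β i)) '' {i | ∃ j ∈ Z, α i j ≠ 0}))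
    (huZ : ∀ j ∈ Z, u j = 0) : u = 0 := by
  have := Fintype.ofFinite n
  have hmem : u ∈ relationLattice A := by
    rw [← span_range_expDiff_eq_relationLattice hspan]
    exact Submodule.span_mono (Set.image_subset_range _ _) hu
  have hdisj : Disjoint {i | ∃ j ∈ Z, α i j ≠ 0} {i | ∀ j ∈ Z, α i j = 0} :=
    Set.disjoint_left.2 fun i ⟨j, hj, hij⟩ hi => hij (hi j hj)
  exact Submodule.disjoint_def.1 (hind.disjoint_span_image hdisj) u hu
    (mem_span_expDiff_of_vanishing hspan Z hZ hmem huZ)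

theorem linearIndependent_expDiff_of_card_le [Fintype ι] {A : Matrix m n ℕ} {α β : ι → n →₀ ℕ}
    (hspan : Ideal.span (Set.range fun i => binomial k (α i) (β i)) = toricIdeal k A)
    (hcard : Fintype.card ι ≤ Module.finrank ℤ (relationLattice A)) :
    LinearIndependent ℤ fun i => expDiff (α i) (β i) := by
  rw [← span_range_expDiff_eq_relationLattice hspan] at hcard
  rw [linearIndependent_iff_card_le_finrank_span]
  exact hcard

end Faces

section Incidence

variable {V : Type*} {G : SimpleGraph V}

open Classical in
theorem incidence_apply (v : V) (e : G.edgeSet) :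
    incidence G v e = if v ∈ (e : Sym2 V) then 1 else 0 := by
  simp only [incidence, Matrix.submatrix_apply, id_eq]
  rw [SimpleGraph.incMatrix_apply']
  exact if_congr ⟨fun h => h.2, fun h => ⟨e.2, h⟩⟩ rfl rfl

open Classical in
/-- The extension by zero of a function on the edges of a graph to all unordered pairs of vertices;
it turns sums over the edges at a vertex into sums over all vertices. -/
noncomputable def edgeExtend (u : G.edgeSet → ℤ) (s : Sym2 V) : ℤ :=
  if h : s ∈ G.edgeSet then u ⟨s, h⟩ else 0

theorem edgeExtend_of_mem (u : G.edgeSet → ℤ) {s : Sym2 V} (h : s ∈ G.edgeSet) :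
    edgeExtend u s = u ⟨s, h⟩ := dif_pos h

theorem mem_edgeSet_of_edgeExtend_ne_zero {u : G.edgeSet → ℤ} {s : Sym2 V}
    (h : edgeExtend u s ≠ 0) : s ∈ G.edgeSet := by
  by_contra hs
  exact h (dif_neg hs)

theorem edgeExtend_diag (u : G.edgeSet → ℤ) (v : V) : edgeExtend u s(v, v) = 0 :=
  dif_neg fun h => G.irrefl h

section FiniteEdges

variable [Fintype G.edgeSet]

theorem mulVec_incidence_ne_zero_iff {α : G.edgeSet →₀ ℕ} {v : V} :
    (incidence G).mulVec α v ≠ 0 ↔ ∃ e : G.edgeSet, v ∈ (e : Sym2 V) ∧ α e ≠ 0 := by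
  classical
  simp [Matrix.mulVec, dotProduct, incidence_apply]

theorem edgeExtend_eq_sum [DecidableEq V] (u : G.edgeSet → ℤ) (s : Sym2 V) :
    edgeExtend u s = ∑ e : G.edgeSet, if (e : Sym2 V) = s then u e else 0 := by
  by_cases hs : s ∈ G.edgeSet
  · simpa only [edgeExtend_of_mem u hs, Subtype.ext_iff] using
      (Fintype.sum_ite_eq' (⟨s, hs⟩ : G.edgeSet) u).symm
  · rw [edgeExtend, dif_neg hs, Finset.sum_eq_zero]
    rintro e -
    exact if_neg fun he : (e : Sym2 V) = s => hs (he ▸ e.2)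

end FiniteEdges

theorem sum_ite_eq_mk [Fintype V] [DecidableEq V] (e : Sym2 V) (v : V) (x : ℤ) :
    (∑ w, if e = s(v, w) then x else 0) = if v ∈ e then x else 0 := by
  by_cases hv : v ∈ e
  · obtain ⟨w, rfl⟩ := hv
    simp_rw [Sym2.congr_right]
    simp
  · rw [if_neg hv, Finset.sum_eq_zero]
    rintro w -
    exact if_neg fun h : e = s(v, w) => hv (h ▸ Sym2.mem_mk_left v w)

theorem sum_mul_incidence [Fintype V] (y : V → ℤ) {v w : V} (h : G.Adj v w) :
    ∑ x, y x * (incidence G x ⟨s(v, w), h⟩ : ℤ) = y v + y w := by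
  classical
  have hx : ∀ x, y x * (incidence G x ⟨s(v, w), h⟩ : ℤ) =
      (if x = v then y x else 0) + if x = w then y x else 0 := by
    intro x
    rw [incidence_apply]
    have := h.ne
    grind
  simp [hx, Finset.sum_add_distrib]

variable [Fintype G.edgeSet] [Fintype V]

theorem sum_incidence_mul (v : V) (u : G.edgeSet → ℤ) :
    ∑ e, (incidence G v e : ℤ) * u e = ∑ w, edgeExtend u s(v, w) := by
  classical
  simp_rw [edgeExtend_eq_sum]
  rw [Finset.sum_comm]
  refine Finset.sum_congr rfl fun e _ => ?_
  rw [sum_ite_eq_mk, incidence_apply, Nat.cast_ite, Nat.cast_one, Nat.cast_zero, boole_mul]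

theorem mem_relationLattice_incidence {u : G.edgeSet → ℤ} :
    u ∈ relationLattice (incidence G) ↔ ∀ v, ∑ w, edgeExtend u s(v, w) = 0 := by
  simp_rw [mem_relationLattice, sum_incidence_mul]

theorem sum_mulVec_incidence (γ : G.edgeSet →₀ ℕ) :
    ∑ v, (incidence G).mulVec γ v = 2 * γ.degree := by
  classical
  simp only [Matrix.mulVec, dotProduct]
  rw [Finset.sum_comm, Finsupp.degree_eq_sum, Finset.mul_sum]
  refine Finset.sum_congr rfl fun e _ => ?_
  rw [← Finset.sum_mul]
  exact congrArg (· * γ e) (G.sum_incMatrix_apply_of_mem_edgeSet e.2)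

omit [Fintype V] in
theorem degree_eq_of_mulVec_incidence_eq [Finite V] {α β : G.edgeSet →₀ ℕ}
    (h : (incidence G).mulVec α = (incidence G).mulVec β) : α.degree = β.degree := by
  have := Fintype.ofFinite V
  have hα := sum_mulVec_incidence α
  rw [h, sum_mulVec_incidence] at hα
  omega

theorem three_mul_card_eq [DecidableRel G.Adj] (hG : G.IsRegularOfDegree 3) :
    3 * Fintype.card V = 2 * Fintype.card G.edgeSet := by
  classical
  have h := G.sum_degrees_eq_twice_card_edges
  simp only [hG.degree_eq, Finset.sum_const, Finset.card_univ, smul_eq_mul] at h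
  rw [mul_comm, h, ← Set.toFinset_card]
  congr!

theorem card_edgeSet_le_finrank_add :
    Fintype.card G.edgeSet ≤ Module.finrank ℤ (relationLattice (incidence G)) +
      Fintype.card V := by
  have hrank := finrank_range_add_finrank_ker ((incidence G).map (Nat.cast : ℕ → ℤ)).mulVecLin
  have hrange := Submodule.finrank_le
    (LinearMap.range ((incidence G).map (Nat.cast : ℕ → ℤ)).mulVecLin)
  rw [Module.finrank_fintype_fun_eq_card] at hrank hrange
  rw [relationLattice]
  omega

/-- Such a `y` is a combination of the signs of the 2-colourings of the bipartite components of `G`,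
so no component is bipartite. -/
theorem eq_zero_of_forall_adj_add_eq_zero
    (h : Module.finrank ℤ (relationLattice (incidence G)) + Fintype.card V ≤
      Fintype.card G.edgeSet)
    {y : V → ℤ} (hy : ∀ v w, G.Adj v w → y v + y w = 0) : y = 0 := by
  rw [relationLattice] at h
  set M := (incidence G).map (Nat.cast : ℕ → ℤ)
  have hyM : Matrix.vecMul y M = 0 := by
    ext ⟨e, he⟩
    induction e using Sym2.ind with
    | _ v w => exact (sum_mul_incidence y he).trans (hy v w he)
  let g : (V → ℤ) →ₗ[ℤ] ℤ := dotProductBilin ℤ ℤ y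
  have hrange : LinearMap.range M.mulVecLin ≤ LinearMap.ker g := by
    rintro _ ⟨x, rfl⟩
    change y ⬝ᵥ M.mulVec x = 0
    rw [Matrix.dotProduct_mulVec, hyM, zero_dotProduct]
  have hle := Submodule.finrank_mono hrange
  have hM := finrank_range_add_finrank_ker M.mulVecLin
  have hg := finrank_range_add_finrank_ker g
  rw [Module.finrank_fintype_fun_eq_card] at hM hg
  have hg0 : LinearMap.range g = ⊥ := Submodule.finrank_eq_zero.1 (by omega)
  exact dotProduct_eq_zero y fun x => LinearMap.congr_fun (LinearMap.range_eq_bot.1 hg0) x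

end Incidence

theorem single_add_single_le {n : Type*} {γ : n →₀ ℕ} {e f : n} (hne : e ≠ f) (he : γ e ≠ 0)
    (hf : γ f ≠ 0) : .single e 1 + .single f 1 ≤ γ := by
  classical
  intro g
  simp only [Finsupp.coe_add, Pi.add_apply, Finsupp.single_apply]
  grind

theorem mulVec_incidence_square {V : Type*} {G : SimpleGraph V} [Fintype G.edgeSet] {a b c d : V}
    (hab : G.Adj a b) (hbc : G.Adj b c) (hcd : G.Adj c d) (had : G.Adj a d) :
    (incidence G).mulVec
        (.single ⟨s(a, b), hab⟩ 1 + .single ⟨s(c, d), hcd⟩ 1 : G.edgeSet →₀ ℕ) =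
      (incidence G).mulVec
        (.single ⟨s(a, d), had⟩ 1 + .single ⟨s(b, c), hbc⟩ 1 : G.edgeSet →₀ ℕ) := by
  classical
  have := hab.ne; have := hbc.ne; have := hcd.ne; have := had.ne
  ext v
  simp only [Finsupp.coe_add, Matrix.mulVec_add, Finsupp.single_eq_pi_single,
    Matrix.mulVec_single_one, Pi.add_apply, Matrix.col_apply, incidence_apply, Sym2.mem_iff]
  grind

/-- A 4-cycle of a graph, given by its vertices in cyclic order. -/
structure FourCycle {V : Type*} (G : SimpleGraph V) where
  (a b c d : V)
  adj_ab : G.Adj a b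
  adj_bc : G.Adj b c
  adj_cd : G.Adj c d
  adj_ad : G.Adj a d
  a_ne_c : a ≠ c
  b_ne_d : b ≠ d

namespace FourCycle

variable {V : Type*} {G : SimpleGraph V} (C : FourCycle G)

/-- The vertices of a 4-cycle. -/
def verts : Set V := {C.a, C.b, C.c, C.d}

/-- The edges of a 4-cycle. -/
def edges : Set (Sym2 V) := {s(C.a, C.b), s(C.b, C.c), s(C.c, C.d), s(C.a, C.d)}

/-- The exponent of the product of the edges `ab` and `cd`, the first term of the quadric of the
cycle. -/
noncomputable def posExp : G.edgeSet →₀ ℕ :=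
  .single ⟨s(C.a, C.b), C.adj_ab⟩ 1 + .single ⟨s(C.c, C.d), C.adj_cd⟩ 1

/-- The exponent of the product of the edges `ad` and `bc`, the second term of the quadric of the
cycle. -/
noncomputable def negExp : G.edgeSet →₀ ℕ :=
  .single ⟨s(C.a, C.d), C.adj_ad⟩ 1 + .single ⟨s(C.b, C.c), C.adj_bc⟩ 1

theorem negExp_ne_zero : C.negExp ≠ 0 := by
  simp [negExp]

theorem posExp_le {γ : G.edgeSet →₀ ℕ} (hab : γ ⟨s(C.a, C.b), C.adj_ab⟩ ≠ 0)
    (hcd : γ ⟨s(C.c, C.d), C.adj_cd⟩ ≠ 0) : C.posExp ≤ γ := by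
  refine single_add_single_le (fun h => ?_) hab hcd
  have := Subtype.ext_iff.1 h; have := C.a_ne_c; have := C.adj_ad.ne
  grind

theorem negExp_le {γ : G.edgeSet →₀ ℕ} (had : γ ⟨s(C.a, C.d), C.adj_ad⟩ ≠ 0)
    (hbc : γ ⟨s(C.b, C.c), C.adj_bc⟩ ≠ 0) : C.negExp ≤ γ := by
  refine single_add_single_le (fun h => ?_) had hbc
  have := Subtype.ext_iff.1 h; have := C.a_ne_c; have := C.adj_ab.ne
  grind

theorem edgeExtend_expDiff_eq_zero {s : Sym2 V} (hs : s ∉ C.edges) :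
    edgeExtend (expDiff C.posExp C.negExp) s = 0 := by
  classical
  by_cases h : s ∈ G.edgeSet
  · rw [edgeExtend_of_mem _ h]
    simp only [edges, Set.mem_insert_iff, Set.mem_singleton_iff, not_or] at hs
    simp only [expDiff, posExp, negExp, Finsupp.coe_add, Pi.add_apply, Finsupp.single_apply,
      Subtype.ext_iff]
    grind
  · exact not_imp_comm.1 mem_edgeSet_of_edgeExtend_ne_zero h

theorem mem_verts_of_mem_edges {v w : V} (h : s(v, w) ∈ C.edges) : v ∈ C.verts := by
  simp only [edges, verts, Set.mem_insert_iff, Set.mem_singleton_iff, Sym2.eq_iff] at *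
  tauto

theorem exists_neighbors {v : V} (h : v ∈ C.verts) :
    ∃ p q, p ≠ q ∧ G.Adj v p ∧ G.Adj v q ∧ ∀ w, s(v, w) ∈ C.edges ↔ w = p ∨ w = q := by
  have hab := C.adj_ab; have hbc := C.adj_bc; have hcd := C.adj_cd; have had := C.adj_ad
  have hne := hab.ne; have := hbc.ne; have := hcd.ne; have := had.ne
  have hac := C.a_ne_c; have hbd := C.b_ne_d
  simp only [edges, Set.mem_insert_iff, Set.mem_singleton_iff, Sym2.eq_iff]
  rcases h with rfl | rfl | rfl | rfl
  · exact ⟨C.b, C.d, hbd, hab, had, by grind⟩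
  · exact ⟨C.a, C.c, hac, hab.symm, hbc, by grind⟩
  · exact ⟨C.b, C.d, hbd, hbc.symm, hcd, by grind⟩
  · exact ⟨C.a, C.c, hac, had.symm, hcd.symm, by grind⟩

theorem adj_opposite {v w x y : V} (hvw : s(v, w) ∈ C.edges) (hvx : s(v, x) ∈ C.edges)
    (hwy : s(w, y) ∈ C.edges) (hxw : x ≠ w) (hyv : y ≠ v) : G.Adj x y := by
  have hab := C.adj_ab; have hbc := C.adj_bc; have hcd := C.adj_cd; have had := C.adj_ad
  have := hab.ne; have := hbc.ne; have := hcd.ne; have := had.ne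
  have := hab.symm; have := hbc.symm; have := hcd.symm; have := had.symm
  have := C.a_ne_c; have := C.b_ne_d
  simp only [edges, Set.mem_insert_iff, Set.mem_singleton_iff, Sym2.eq_iff] at hvw hvx hwy
  grind

variable [Fintype G.edgeSet]

theorem mulVec_posExp_eq : (incidence G).mulVec C.posExp = (incidence G).mulVec C.negExp :=
  mulVec_incidence_square C.adj_ab C.adj_bc C.adj_cd C.adj_ad

theorem mulVec_posExp_ne_zero_iff {v : V} :
    (incidence G).mulVec C.posExp v ≠ 0 ↔ v ∈ C.verts := by
  classical
  simp only [posExp, Finsupp.coe_add, Matrix.mulVec_add, Finsupp.single_eq_pi_single,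
    Matrix.mulVec_single_one, Pi.add_apply, Matrix.col_apply, incidence_apply, Sym2.mem_iff, verts,
    Set.mem_insert_iff, Set.mem_singleton_iff]
  grind

end FourCycle

section BalancedWeights

variable {V : Type*} [Fintype V]

/-- An integral weight on the pairs of vertices whose sum over the pairs at each vertex is zero: the
extension by zero of a vector of the relation lattice of a graph. -/
structure IsBalanced (f : Sym2 V → ℤ) : Prop where
  diag : ∀ v, f s(v, v) = 0
  sum_eq_zero : ∀ v, ∑ w, f s(v, w) = 0

theorem isBalanced_edgeExtend {G : SimpleGraph V} [Fintype G.edgeSet] {u : G.edgeSet → ℤ}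
    (hu : u ∈ relationLattice (incidence G)) : IsBalanced (edgeExtend u) :=
  ⟨edgeExtend_diag u, mem_relationLattice_incidence.1 hu⟩

namespace IsBalanced

variable {f : Sym2 V → ℤ} (hf : IsBalanced f)

include hf

theorem exists_neg {v w : V} (h : 0 < f s(v, w)) : ∃ x, f s(v, x) < 0 := by
  by_contra! hneg
  exact h.ne' ((Finset.sum_eq_zero_iff_of_nonneg fun x _ => hneg x).1 (hf.sum_eq_zero v) w
    (Finset.mem_univ w))

theorem exists_pos {v w : V} (h : f s(v, w) < 0) : ∃ x, 0 < f s(v, x) := by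
  by_contra! hpos
  exact h.ne ((Finset.sum_eq_zero_iff_of_nonpos fun x _ => hpos x).1 (hf.sum_eq_zero v) w
    (Finset.mem_univ w))

theorem exists_pos_of_ne_zero (h : f ≠ 0) : ∃ v w, 0 < f s(v, w) := by
  obtain ⟨s, hs⟩ := Function.ne_iff.1 h
  induction s using Sym2.ind with
  | _ v w =>
    rcases lt_or_gt_of_ne hs with h | h
    exacts [⟨v, hf.exists_pos h⟩, ⟨v, w, h⟩]

/-- Follow a negative pair from `v` and one from `w`; if they end in the same vertex, continue with
a positive pair from there. -/
theorem exists_two_more [DecidableEq V] {v w : V} (h : 0 < f s(v, w)) {W : Finset V}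
    (hW : ∀ x y, f s(x, y) ≠ 0 → x ∈ W) :
    ∃ p q, ({v, w, p, q} : Finset V) ⊆ W ∧ ({v, w, p, q} : Finset V).card = 4 := by
  have hswap : ∀ x y, f s(x, y) = f s(y, x) := fun x y => by rw [Sym2.eq_swap]
  have hW' : ∀ x y, f s(x, y) ≠ 0 → y ∈ W := fun x y hxy => hW y x (hswap x y ▸ hxy)
  have hdiag := hf.diag
  suffices ∃ p q, p ∈ W ∧ q ∈ W ∧ p ≠ q ∧ v ≠ p ∧ v ≠ q ∧ w ≠ p ∧ w ≠ q by
    obtain ⟨p, q, hp, hq, hpq, hvp, hvq, hwp, hwq⟩ := this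
    have hv := hW v w h.ne'
    have hw := hW' v w h.ne'
    have hvw : v ≠ w := by rintro rfl; exact h.ne' (hdiag v)
    refine ⟨p, q, by grind, ?_⟩
    grind
  obtain ⟨z, hz⟩ := hf.exists_neg h
  obtain ⟨y, hy⟩ := hf.exists_neg (hswap v w ▸ h)
  by_cases hzy : z = y
  · subst hzy
    obtain ⟨q, hq⟩ := hf.exists_pos (hswap v z ▸ hz)
    exact ⟨z, q, hW' v z hz.ne, hW' z q hq.ne', by grind⟩
  · exact ⟨z, y, hW' v z hz.ne, hW' w y hy.ne, by grind⟩

theorem four_le_card (h : f ≠ 0) {W : Finset V} (hW : ∀ x y, f s(x, y) ≠ 0 → x ∈ W) :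
    4 ≤ W.card := by
  classical
  obtain ⟨v, w, hvw⟩ := hf.exists_pos_of_ne_zero h
  obtain ⟨p, q, hsub, hcard⟩ := hf.exists_two_more hvw hW
  exact hcard ▸ Finset.card_le_card hsub

theorem exists_alternating_cycle (h : f ≠ 0) {W : Finset V}
    (hW : ∀ x y, f s(x, y) ≠ 0 → x ∈ W) (hcard : W.card = 4) :
    ∃ a b c d, a ≠ c ∧ b ≠ d ∧
      0 < f s(a, b) ∧ f s(b, c) < 0 ∧ 0 < f s(c, d) ∧ f s(a, d) < 0 := by
  classical
  have hswap : ∀ x y, f s(x, y) = f s(y, x) := fun x y => by rw [Sym2.eq_swap]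
  obtain ⟨v, w, hvw⟩ := hf.exists_pos_of_ne_zero h
  obtain ⟨p, q, hsub, hcard'⟩ := hf.exists_two_more hvw hW
  obtain rfl := Finset.eq_of_subset_of_card_le hsub (hcard.trans hcard'.symm).le
  obtain ⟨⟨-, hvp, hvq⟩, ⟨hwp, hwq⟩, hpq⟩ : (v ≠ w ∧ v ≠ p ∧ v ≠ q) ∧ (w ≠ p ∧ w ≠ q) ∧ p ≠ q := by
    grind
  have hsum : ∀ x, f s(x, v) + f s(x, w) + f s(x, p) + f s(x, q) = 0 := by
    intro x
    rw [← hf.sum_eq_zero x, ← Finset.sum_subset (Finset.subset_univ {v, w, p, q})]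
    · rw [Finset.sum_insert (by grind), Finset.sum_insert (by grind), Finset.sum_pair hpq]
      ring
    · intro y _ hy
      rw [hswap]
      exact not_imp_comm.1 (hW y x) hy
  have hv := hsum v
  have hw := hsum w
  have hp := hsum p
  have hq := hsum q
  rw [hf.diag] at hv hw hp hq
  rw [hswap w v] at hw
  rw [hswap p v, hswap p w] at hp
  rw [hswap q v, hswap q w, hswap q p] at hq
  rcases lt_or_ge (f s(v, p)) 0 with hneg | hnonneg
  · exact ⟨v, w, q, p, hvq, hwp, hvw, by linarith, by rw [hswap]; linarith, hneg⟩
  · exact ⟨v, w, p, q, hvp, hwq, hvw, by linarith, by linarith, by linarith⟩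

end IsBalanced

end BalancedWeights

section MinimalGenerators

variable {V : Type*} {G : SimpleGraph V} {α β : G.edgeSet →₀ ℕ}

theorem edgeExtend_expDiff_ne_zero (h : α ≠ β) : edgeExtend (expDiff α β) ≠ 0 := by
  obtain ⟨e, he⟩ := Finsupp.ne_iff.1 h
  intro hzero
  have hdiff := congrFun hzero e
  rw [edgeExtend_of_mem _ e.2, Pi.zero_apply, expDiff, sub_eq_zero, Nat.cast_inj] at hdiff
  exact he hdiff

theorem ne_zero_of_edgeExtend_expDiff_pos {s : Sym2 V} (hs : s ∈ G.edgeSet)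
    (h : 0 < edgeExtend (expDiff α β) s) : α ⟨s, hs⟩ ≠ 0 := by
  rw [edgeExtend_of_mem _ hs, expDiff] at h
  omega

theorem ne_zero_of_edgeExtend_expDiff_neg {s : Sym2 V} (hs : s ∈ G.edgeSet)
    (h : edgeExtend (expDiff α β) s < 0) : β ⟨s, hs⟩ ≠ 0 := by
  rw [edgeExtend_of_mem _ hs, expDiff] at h
  omega

variable [Fintype G.edgeSet]

theorem mulVec_ne_zero_of_edgeExtend_ne_zero
    (hαβ : (incidence G).mulVec α = (incidence G).mulVec β) {v w : V}
    (h : edgeExtend (expDiff α β) s(v, w) ≠ 0) : (incidence G).mulVec α v ≠ 0 := by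
  have hvw := mem_edgeSet_of_edgeExtend_ne_zero h
  rw [edgeExtend_of_mem _ hvw] at h
  by_cases hα : α ⟨s(v, w), hvw⟩ = 0
  · have hβ : β ⟨s(v, w), hvw⟩ ≠ 0 := fun hβ => h (by simp [expDiff, hα, hβ])
    exact hαβ ▸ mulVec_incidence_ne_zero_iff.2 ⟨_, Sym2.mem_mk_left v w, hβ⟩
  · exact mulVec_incidence_ne_zero_iff.2 ⟨_, Sym2.mem_mk_left v w, hα⟩

namespace IsMinimalBinomial

variable {k : Type*} [Field k] [Fintype V] (hmin : IsMinimalBinomial k (incidence G) α β)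
  {W : Finset V}

include hmin

theorem isBalanced : IsBalanced (edgeExtend (expDiff α β)) :=
  isBalanced_edgeExtend (expDiff_mem_relationLattice.2 hmin.mulVec_eq)

theorem four_le_card (hW : ∀ v, (incidence G).mulVec α v ≠ 0 → v ∈ W) : 4 ≤ W.card :=
  hmin.isBalanced.four_le_card (edgeExtend_expDiff_ne_zero hmin.ne) fun v _ hv =>
    hW v (mulVec_ne_zero_of_edgeExtend_ne_zero hmin.mulVec_eq hv)

theorem exists_fourCycle (hW : ∀ v, (incidence G).mulVec α v ≠ 0 → v ∈ W) (hcard : W.card = 4) :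
    ∃ C : FourCycle G, α = C.posExp ∧ β = C.negExp := by
  classical
  obtain ⟨a, b, c, d, hac, hbd, hab, hbc, hcd, had⟩ :=
    hmin.isBalanced.exists_alternating_cycle (edgeExtend_expDiff_ne_zero hmin.ne)
      (fun v _ hv => hW v (mulVec_ne_zero_of_edgeExtend_ne_zero hmin.mulVec_eq hv)) hcard
  have adj_of_pos : ∀ {x y}, 0 < edgeExtend (expDiff α β) s(x, y) → G.Adj x y :=
    fun h => mem_edgeSet_of_edgeExtend_ne_zero h.ne'
  have adj_of_neg : ∀ {x y}, edgeExtend (expDiff α β) s(x, y) < 0 → G.Adj x y :=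
    fun h => mem_edgeSet_of_edgeExtend_ne_zero h.ne
  let C : FourCycle G := ⟨a, b, c, d, adj_of_pos hab, adj_of_neg hbc, adj_of_pos hcd,
    adj_of_neg had, hac, hbd⟩
  exact ⟨C, hmin.eq_of_le (fun _ _ => degree_eq_of_mulVec_incidence_eq) C.mulVec_posExp_eq
    (C.posExp_le (ne_zero_of_edgeExtend_expDiff_pos C.adj_ab hab)
      (ne_zero_of_edgeExtend_expDiff_pos C.adj_cd hcd))
    (C.negExp_le (ne_zero_of_edgeExtend_expDiff_neg C.adj_ad had)
      (ne_zero_of_edgeExtend_expDiff_neg C.adj_bc hbc)) C.negExp_ne_zero⟩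

end IsMinimalBinomial

end MinimalGenerators

section DoubleCounting

open Finset in
theorem card_eq_of_card_mul_le {V ι : Type*} [Fintype V] [Fintype ι] (R : V → ι → Prop)
    [∀ v i, Decidable (R v i)] {m n : ℕ} (hm : ∀ v, #{i | R v i} ≤ m) (hn : ∀ i, n ≤ #{v | R v i})
    (hmn : Fintype.card V * m ≤ Fintype.card ι * n) :
    Fintype.card V * m = Fintype.card ι * n ∧
      (∀ v, #{i | R v i} = m) ∧ ∀ i, #{v | R v i} = n := by
  have hdouble : ∑ v, #{i | R v i} = ∑ i, #{v | R v i} :=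
    sum_card_bipartiteAbove_eq_sum_card_bipartiteBelow R
  have hle : ∑ v, #{i | R v i} ≤ ∑ _v : V, m := sum_le_sum fun v _ => hm v
  have hge : ∑ _i : ι, n ≤ ∑ i, #{v | R v i} := sum_le_sum fun i _ => hn i
  have hV : ∑ _v : V, m = Fintype.card V * m := by simp
  have hι : ∑ _i : ι, n = Fintype.card ι * n := by simp
  have hVeq := (sum_eq_sum_iff_of_le fun v _ => hm v).1 (show _ = ∑ _v : V, m by omega)
  have hιeq := (sum_eq_sum_iff_of_le fun i _ => hn i).1 (show ∑ _i : ι, n = _ by omega)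
  exact ⟨by omega, fun v => hVeq v (mem_univ v), fun i => (hιeq i (mem_univ i)).symm⟩

end DoubleCounting

section CubicGraphs

variable {V : Type*} [Fintype V] {G : SimpleGraph V} [DecidableRel G.Adj]

theorem exists_adj_of_regular (hG : G.IsRegularOfDegree 3) (v : V) : ∃ x, G.Adj v x :=
  (G.degree_pos_iff_exists_adj v).1 (by simp [hG.degree_eq])

theorem exists_neighbors_of_adj (hG : G.IsRegularOfDegree 3) {v x : V} (hx : G.Adj v x) :
    ∃ y z, x ≠ y ∧ x ≠ z ∧ y ≠ z ∧ ∀ w, G.Adj v w ↔ w = x ∨ w = y ∨ w = z := by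
  classical
  have hcard : ((G.neighborFinset v).erase x).card = 2 := by
    rw [Finset.card_erase_of_mem (by simpa using hx), G.card_neighborFinset_eq_degree,
      hG.degree_eq]
  obtain ⟨y, z, hyz, h⟩ := Finset.card_eq_two.1 hcard
  have hmem : ∀ w, w ≠ x ∧ G.Adj v w ↔ w = y ∨ w = z := fun w => by
    simpa using Finset.ext_iff.1 h w
  refine ⟨y, z, ((hmem y).2 (Or.inl rfl)).1.symm, ((hmem z).2 (Or.inr rfl)).1.symm, hyz,
    fun w => ?_⟩
  by_cases hw : w = x
  · simp [hw, hx]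
  · simp [← hmem, hw]

end CubicGraphs

section IndependentGenerators

variable {k : Type*} [Field k] {V : Type*} {G : SimpleGraph V}

theorem eq_of_linearIndependent_prod {ι : Type*} {f g : ι → ℤ}
    (h : LinearIndependent ℤ fun i => (f i, g i)) {i j : ι} (hi : f i = 0) (hj : f j = 0) :
    i = j := by
  by_contra hij
  have hpair := (LinearIndepOn.pair_iff _ hij).1 (h.linearIndepOn {i, j})
  obtain ⟨-, hgi⟩ := hpair (g j) (-g i) (by simp [hi, hj, mul_comm])
  obtain ⟨hone, -⟩ := hpair 1 0 (by simp [hi, neg_eq_zero.1 hgi])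
  exact one_ne_zero hone

variable [Fintype V] [Fintype G.edgeSet]

omit [Fintype V] in
theorem edgeExtend_eq_zero_of_mem_relationLattice [Finite V] {u : G.edgeSet → ℤ}
    (hu : u ∈ relationLattice (incidence G)) {v x y z : V}
    (h : ∀ w, G.Adj v w → w = x ∨ w = y ∨ w = z) (hx : edgeExtend u s(v, x) = 0)
    (hy : edgeExtend u s(v, y) = 0) (w : V) : edgeExtend u s(v, w) = 0 := by
  have := Fintype.ofFinite V
  have hother : ∀ w, w ≠ z → edgeExtend u s(v, w) = 0 := by
    intro w hwz
    by_contra hw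
    rcases h w (mem_edgeSet_of_edgeExtend_ne_zero hw) with rfl | rfl | rfl
    exacts [hw hx, hw hy, hwz rfl]
  by_cases hwz : w = z
  · rw [← mem_relationLattice_incidence.1 hu v, hwz, Fintype.sum_eq_single z hother]
  · exact hother w hwz

variable {ι : Type*} {α β : ι → G.edgeSet →₀ ℕ}
  (hspan : Ideal.span (Set.range fun i => binomial k (α i) (β i)) = toricIdeal k (incidence G))
  (hind : LinearIndependent ℤ fun i => expDiff (α i) (β i)) {v x y z : V}
  (h : ∀ w, G.Adj v w ↔ w = x ∨ w = y ∨ w = z)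

include hspan hind h

/-- The edges not at `v` form a face: a combination of the generators through `v` that vanishes on
all edges at `v` is also a combination of the other generators, hence zero. -/
theorem linearIndependent_restrict :
    LinearIndependent ℤ fun i : {i // (incidence G).mulVec (α i) v ≠ 0} =>
      (edgeExtend (expDiff (α i) (β i)) s(v, x), edgeExtend (expDiff (α i) (β i)) s(v, y)) := by
  have hvx : G.Adj v x := (h x).2 (by simp)
  have hvy : G.Adj v y := (h y).2 (by simp)
  let atEdges : (G.edgeSet → ℤ) →ₗ[ℤ] ℤ × ℤ :=
    (LinearMap.proj ⟨s(v, x), hvx⟩).prod (LinearMap.proj ⟨s(v, y), hvy⟩)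
  have hatEdges : ∀ u, atEdges u = (edgeExtend u s(v, x), edgeExtend u s(v, y)) := fun u => by
    rw [edgeExtend_of_mem u hvx, edgeExtend_of_mem u hvy]
    rfl
  have hmem : ∀ i, expDiff (α i) (β i) ∈ relationLattice (incidence G) := fun i => by
    rw [← span_range_expDiff_eq_relationLattice hspan]
    exact Submodule.subset_span ⟨i, rfl⟩
  have hdisj : Disjoint (Submodule.span ℤ (Set.range fun i :
      {i // (incidence G).mulVec (α i) v ≠ 0} => expDiff (α i) (β i))) (LinearMap.ker atEdges) := by
    refine Submodule.disjoint_def.2 fun u hu hker => ?_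
    rw [LinearMap.mem_ker, hatEdges, Prod.mk_eq_zero] at hker
    have hlattice : u ∈ relationLattice (incidence G) :=
      Submodule.span_le.2 (by rintro _ ⟨i, rfl⟩; exact hmem i) hu
    refine eq_zero_of_mem_span_expDiff_of_vanishing hspan hind {e | v ∈ (e : Sym2 V)} (fun i => ?_)
      (Submodule.span_mono ?_ hu) ?_
    · simp only [Set.mem_ofPred_eq, ← mulVec_incidence_ne_zero_iff]
      rw [expDiff_mem_relationLattice.1 (hmem i)]
    · rintro _ ⟨i, rfl⟩
      exact ⟨i, mulVec_incidence_ne_zero_iff.1 i.2, rfl⟩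
    · rintro ⟨e, he⟩ ⟨w, rfl⟩
      rw [← edgeExtend_of_mem u he]
      exact edgeExtend_eq_zero_of_mem_relationLattice hlattice (fun w => (h w).1) hker.1 hker.2 w
  simpa only [Function.comp_def, hatEdges] using
    (hind.comp (Subtype.val : {i // (incidence G).mulVec (α i) v ≠ 0} → ι)
      Subtype.val_injective).map hdisj

theorem card_generators_through_le_two [Fintype {i // (incidence G).mulVec (α i) v ≠ 0}] :
    Fintype.card {i // (incidence G).mulVec (α i) v ≠ 0} ≤ 2 := by
  simpa using (linearIndependent_restrict hspan hind h).fintype_card_le_finrank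

theorem edgeExtend_ne_zero_or_of_ne {i j : ι} (hij : i ≠ j)
    (hi : (incidence G).mulVec (α i) v ≠ 0) (hj : (incidence G).mulVec (α j) v ≠ 0) :
    edgeExtend (expDiff (α i) (β i)) s(v, x) ≠ 0 ∨
      edgeExtend (expDiff (α j) (β j)) s(v, x) ≠ 0 := by
  by_contra! hzero
  exact hij (congrArg Subtype.val (eq_of_linearIndependent_prod
    (linearIndependent_restrict hspan hind h) (i := ⟨i, hi⟩) (j := ⟨j, hj⟩) hzero.1 hzero.2))

end IndependentGenerators

section CompleteIntersections

variable {k : Type*} [Field k] {V : Type*} {G : SimpleGraph V}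

/-- Two 4-cycles of the family pass through each vertex, and every edge at the vertex lies on at
least one of them. -/
structure IsFourCycleSystem {ι : Type*} (C : ι → FourCycle G) : Prop where
  ncard_eq_two : ∀ v, {i | v ∈ (C i).verts}.ncard = 2
  mem_edges_or : ∀ {v w : V} {i j : ι}, G.Adj v w → i ≠ j → v ∈ (C i).verts →
    v ∈ (C j).verts → s(v, w) ∈ (C i).edges ∨ s(v, w) ∈ (C j).edges

variable [Fintype V] [Fintype G.edgeSet]

theorem spanFinrank_graphIdeal_of_isCompleteIntersection
    (hci : IsCompleteIntersection (graphIdeal k G)) :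
    Submodule.spanFinrank (graphIdeal k G) =
      Module.finrank ℤ (relationLattice (incidence G)) := by
  rw [IsCompleteIntersection, graphIdeal, height_toricIdeal] at hci
  exact_mod_cast hci

variable [DecidableRel G.Adj] (hG : G.IsRegularOfDegree 3) {ι : Type*} [Fintype ι]
  {α β : ι → G.edgeSet →₀ ℕ}
  (hspan : Ideal.span (Set.range fun i => binomial k (α i) (β i)) = toricIdeal k (incidence G))
  (hind : LinearIndependent ℤ fun i => expDiff (α i) (β i))

include hspan hind in
omit [DecidableRel G.Adj] in
theorem finrank_relationLattice_eq_of_linearIndependent :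
    Module.finrank ℤ (relationLattice (incidence G)) = Fintype.card ι := by
  rw [← span_range_expDiff_eq_relationLattice hspan, finrank_span_eq_card hind]

include hG hspan hind

open Finset in
/-- Each minimal generator meets at least four vertices and each vertex at most two generators,
while there are at least `|E| - |V| = |V| / 2` generators. So there is equality everywhere. -/
theorem generators_vertices_double_counting
    (hmin : ∀ i, IsMinimalBinomial k (incidence G) (α i) (β i)) :
    Fintype.card V * 2 = Fintype.card ι * 4 ∧
      (∀ v, #{i | (incidence G).mulVec (α i) v ≠ 0} = 2) ∧
      ∀ i, #{v | (incidence G).mulVec (α i) v ≠ 0} = 4 := by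
  classical
  refine card_eq_of_card_mul_le (fun v i => (incidence G).mulVec (α i) v ≠ 0)
    (fun v => ?_) (fun i => (hmin i).four_le_card fun v hv => by simpa using hv) ?_
  · obtain ⟨x, hx⟩ := exists_adj_of_regular hG v
    obtain ⟨y, z, -, -, -, h⟩ := exists_neighbors_of_adj hG hx
    rw [← Fintype.card_subtype]
    exact card_generators_through_le_two hspan hind h
  · have hr := finrank_relationLattice_eq_of_linearIndependent hspan hind
    have hrank := card_edgeSet_le_finrank_add (G := G)
    have hdegree := three_mul_card_eq hG
    omega

theorem isFourCycleSystem_of_posExp_of_negExp {C : ι → FourCycle G}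
    (htwo : ∀ v, (Finset.univ.filter fun i => (incidence G).mulVec (α i) v ≠ 0).card = 2)
    (hα : ∀ i, α i = (C i).posExp) (hβ : ∀ i, β i = (C i).negExp) : IsFourCycleSystem C where
  ncard_eq_two v := by
    rw [← htwo v, ← Set.ncard_coe_finset]
    simp [hα, FourCycle.mulVec_posExp_ne_zero_iff]
  mem_edges_or {v w i j} hvw hij hi hj := by
    obtain ⟨y, z, -, -, -, h⟩ := exists_neighbors_of_adj hG hvw
    have hne := edgeExtend_ne_zero_or_of_ne hspan hind h hij
      (by rwa [hα, FourCycle.mulVec_posExp_ne_zero_iff])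
      (by rwa [hα, FourCycle.mulVec_posExp_ne_zero_iff])
    simp only [hα, hβ] at hne
    exact hne.imp (not_imp_comm.1 (C i).edgeExtend_expDiff_eq_zero)
      (not_imp_comm.1 (C j).edgeExtend_expDiff_eq_zero)

omit hspan hind

theorem exists_isFourCycleSystem_of_isCompleteIntersection
    (hci : IsCompleteIntersection (graphIdeal k G)) :
    Module.finrank ℤ (relationLattice (incidence G)) + Fintype.card V ≤ Fintype.card G.edgeSet ∧
      ∃ (r : ℕ) (C : Fin r → FourCycle G), IsFourCycleSystem C := by
  classical
  obtain ⟨r, α, β, hr, hmin, hspan⟩ := exists_minimal_binomial_generators (k := k)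
    (A := incidence G) fun _ _ => degree_eq_of_mulVec_incidence_eq
  have hrank : r ≤ Module.finrank ℤ (relationLattice (incidence G)) :=
    hr.trans (spanFinrank_graphIdeal_of_isCompleteIntersection hci).le
  have hind := linearIndependent_expDiff_of_card_le hspan (by rwa [Fintype.card_fin])
  obtain ⟨hcard, htwo, hfour⟩ :=
    generators_vertices_double_counting hG hspan hind hmin
  choose C hα hβ using fun i => (hmin i).exists_fourCycle (fun v hv => by simpa using hv) (hfour i)
  refine ⟨?_, r, C, isFourCycleSystem_of_posExp_of_negExp hG hspan hind htwo hα hβ⟩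
  have hr := finrank_relationLattice_eq_of_linearIndependent hspan hind
  have hdegree := three_mul_card_eq hG
  omega

end CompleteIntersections

section Rungs

variable {V : Type*} {G : SimpleGraph V}

/-- `vw` is an edge of `G` other than the rung `{v, τ v}` at `v`. -/
def IsSide (G : SimpleGraph V) (τ : V → V) (v w : V) : Prop :=
  G.Adj v w ∧ w ≠ τ v

/-- A perfect matching of `G`, whose edges are called rungs, encoded by the involution `τ` that
exchanges the ends of each rung, such that each vertex lies on two edges that are not rungs, called
sides, and `τ` maps sides to edges. -/
structure IsRungInvolution (G : SimpleGraph V) (τ : V → V) : Prop where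
  adj : ∀ v, G.Adj v (τ v)
  involutive : Function.Involutive τ
  map_adj : ∀ {v w}, IsSide G τ v w → G.Adj (τ v) (τ w)
  exists_sides : ∀ v, ∃ p q, p ≠ q ∧ ∀ w, IsSide G τ v w ↔ w = p ∨ w = q

variable [Fintype V] [DecidableRel G.Adj] (hG : G.IsRegularOfDegree 3)
  {ι : Type*} {C : ι → FourCycle G} (hC : IsFourCycleSystem C)

include hG hC

/-- Two pairs of edges that cover the three edges at `v` have exactly one edge in common. -/
theorem IsFourCycleSystem.exists_common_neighbor (v : V) :
    ∃ m, G.Adj v m ∧ (∀ i, v ∈ (C i).verts → s(v, m) ∈ (C i).edges) ∧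
      ∀ w, (∀ i, v ∈ (C i).verts → s(v, w) ∈ (C i).edges) → w = m := by
  classical
  obtain ⟨i, j, hij, hset⟩ := Set.ncard_eq_two.1 (hC.ncard_eq_two v)
  have hmem : ∀ l, v ∈ (C l).verts ↔ l = i ∨ l = j := Set.ext_iff.1 hset
  have hi := (hmem i).2 (Or.inl rfl)
  have hj := (hmem j).2 (Or.inr rfl)
  obtain ⟨p, q, hpq, hvp, hvq, hCi⟩ := (C i).exists_neighbors hi
  obtain ⟨p', q', hpq', hvp', hvq', hCj⟩ := (C j).exists_neighbors hj
  obtain ⟨y, z, hpy, hpz, hyz, hadj⟩ := exists_neighbors_of_adj hG hvp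
  have hcover : ∀ w, G.Adj v w → (w = p ∨ w = q) ∨ w = p' ∨ w = q' := fun w hw => by
    rw [← hCi, ← hCj]
    exact hC.mem_edges_or hw hij hi hj
  have hy := hcover y ((hadj y).2 (by simp))
  have hz := hcover z ((hadj z).2 (by simp))
  rw [hadj] at hvq
  have hp' := (hadj p').1 hvp'
  have hq' := (hadj q').1 hvq'
  obtain ⟨m, hvm, hm⟩ : ∃ m, G.Adj v m ∧ ∀ w, (w = p ∨ w = q) ∧ (w = p' ∨ w = q') ↔ w = m := by
    by_cases h : p' = p ∨ p' = q
    · exact ⟨p', hvp', fun w => by grind⟩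
    · exact ⟨q', hvq', fun w => by grind⟩
  refine ⟨m, hvm, fun l hl => ?_, fun w hw => (hm w).1 ⟨(hCi w).1 (hw i hi), (hCj w).1 (hw j hj)⟩⟩
  obtain ⟨hmi, hmj⟩ := (hm m).2 rfl
  rcases (hmem l).1 hl with rfl | rfl
  exacts [(hCi m).2 hmi, (hCj m).2 hmj]

omit hG [Fintype V] [DecidableRel G.Adj] in
theorem IsFourCycleSystem.exists_mem_edges {v w : V} (hvw : G.Adj v w) :
    ∃ i, s(v, w) ∈ (C i).edges := by
  obtain ⟨i, j, hij, hset⟩ := Set.ncard_eq_two.1 (hC.ncard_eq_two v)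
  have hi : v ∈ (C i).verts := (Set.ext_iff.1 hset i).2 (Or.inl rfl)
  have hj : v ∈ (C j).verts := (Set.ext_iff.1 hset j).2 (Or.inr rfl)
  exact (hC.mem_edges_or hvw hij hi hj).elim (fun h => ⟨i, h⟩) fun h => ⟨j, h⟩

theorem IsFourCycleSystem.exists_isRungInvolution : ∃ τ, IsRungInvolution G τ := by
  choose τ hadj hedges huniq using hC.exists_common_neighbor hG
  have hverts : ∀ v i, v ∈ (C i).verts → τ v ∈ (C i).verts := fun v i hi =>
    (C i).mem_verts_of_mem_edges (Sym2.eq_swap ▸ hedges v i hi)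
  have hinvol : Function.Involutive τ := by
    intro v
    have heq : {i | v ∈ (C i).verts} = {i | τ v ∈ (C i).verts} :=
      Set.eq_of_subset_of_ncard_le (hverts v)
        (by rw [hC.ncard_eq_two, hC.ncard_eq_two])
        (Set.finite_of_ncard_ne_zero (by simp [hC.ncard_eq_two]))
    refine (huniq (τ v) v fun i hi => ?_).symm
    rw [Sym2.eq_swap]
    exact hedges v i ((Set.ext_iff.1 heq i).2 hi)
  refine ⟨τ, hadj, hinvol, fun {v w} ⟨hvw, hw⟩ => ?_, fun v => ?_⟩
  · obtain ⟨i, hi⟩ := hC.exists_mem_edges hvw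
    refine (C i).adj_opposite hi (hedges v i ((C i).mem_verts_of_mem_edges hi))
      (hedges w i ((C i).mem_verts_of_mem_edges (Sym2.eq_swap ▸ hi))) hw.symm fun h => hw ?_
    rw [← h, hinvol]
  · obtain ⟨y, z, hy, hz, hyz, h⟩ := exists_neighbors_of_adj hG (hadj v)
    exact ⟨y, z, hyz, fun w => by rw [IsSide, h]; grind⟩

end Rungs

section Labelling

variable {V : Type*} {G : SimpleGraph V} {τ : V → V}

namespace IsRungInvolution

theorem isSide_symm (h : IsRungInvolution G τ) {v w : V} (hs : IsSide G τ v w) :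
    IsSide G τ w v :=
  ⟨hs.1.symm, fun hv => hs.2 (by rw [hv, h.involutive])⟩

theorem isSide_map (h : IsRungInvolution G τ) {v w : V} (hs : IsSide G τ v w) :
    IsSide G τ (τ v) (τ w) :=
  ⟨h.map_adj hs, fun hv => hs.2 (h.involutive.injective hv)⟩

variable {φ : V → V}

theorem involutive_of_mem (h : IsRungInvolution G τ) (hφ : φ ∈ ({id, τ} : Set (V → V))) :
    Function.Involutive φ := by
  rcases hφ with rfl | rfl
  exacts [fun _ => rfl, h.involutive]

theorem isSide_map_of_mem (h : IsRungInvolution G τ) (hφ : φ ∈ ({id, τ} : Set (V → V))) {v w : V}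
    (hs : IsSide G τ v w) : IsSide G τ (φ v) (φ w) := by
  rcases hφ with rfl | rfl
  exacts [hs, h.isSide_map hs]

end IsRungInvolution

theorem IsSide.ne_of_mem {φ : V → V} {v w : V} (hs : IsSide G τ v w)
    (hφ : φ ∈ ({id, τ} : Set (V → V))) : w ≠ φ v := by
  rcases hφ with rfl | rfl
  exacts [hs.1.ne', hs.2]

/-- An infinite walk along sides that leaves every vertex by the other of the two sides there. -/
structure IsSideWalk (G : SimpleGraph V) (τ : V → V) (a : ℕ → V) : Prop where
  isSide : ∀ i, IsSide G τ (a i) (a (i + 1))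
  ne : ∀ i, a (i + 2) ≠ a i
  eq_or_eq : ∀ {i w}, IsSide G τ (a (i + 1)) w → w = a i ∨ w = a (i + 2)

theorem IsRungInvolution.exists_isSideWalk (h : IsRungInvolution G τ) (v : V) :
    ∃ a, IsSideWalk G τ a := by
  have hnext : ∀ p x, ∃ q, IsSide G τ x p → q ≠ p ∧ ∀ w, IsSide G τ x w ↔ w = p ∨ w = q := by
    intro p x
    obtain ⟨y, z, hyz, hx⟩ := h.exists_sides x
    by_cases hp : p = y
    · exact ⟨z, fun _ => ⟨hp ▸ hyz.symm, hp ▸ hx⟩⟩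
    · refine ⟨y, fun hs => ⟨Ne.symm hp, fun w => ?_⟩⟩
      rw [hx, ((hx p).1 hs).resolve_left hp, or_comm]
  choose next hnext using hnext
  obtain ⟨y, z, -, hy⟩ := h.exists_sides v
  let P : ℕ → V × V := fun i => Nat.rec (v, y) (fun _ q => (q.2, next q.1 q.2)) i
  have hside : ∀ i, IsSide G τ (P i).1 (P (i + 1)).1 := by
    intro i
    induction i with
    | zero => exact (hy y).2 (Or.inl rfl)
    | succ i ih => exact ((hnext (P i).1 (P (i + 1)).1 (h.isSide_symm ih)).2 _).2 (Or.inr rfl)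
  have hP : ∀ i, (P (i + 2)).1 ≠ (P i).1 ∧
      ∀ w, IsSide G τ (P (i + 1)).1 w ↔ w = (P i).1 ∨ w = (P (i + 2)).1 := fun i =>
    hnext (P i).1 (P (i + 1)).1 (h.isSide_symm (hside i))
  exact ⟨fun i => (P i).1, hside, fun i => (hP i).1, fun {i w} => ((hP i).2 w).1⟩

namespace IsSideWalk

variable {a : ℕ → V} (ha : IsSideWalk G τ a) (h : IsRungInvolution G τ)

include ha h

/-- A side walk first returns to the rungs that it has visited at its initial rung, since every
later rung has been left and entered by all its sides. -/
theorem exists_first_return [Finite V] :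
    ∃ n, ∃ φ ∈ ({id, τ} : Set (V → V)), a (n + 1) = φ (a 0) ∧
      ∀ i j, i < j → j ≤ n → ∀ ψ ∈ ({id, τ} : Set (V → V)), a j ≠ ψ (a i) := by
  classical
  have hex : ∃ j, ∃ i < j, ∃ φ ∈ ({id, τ} : Set (V → V)), a j = φ (a i) := by
    obtain ⟨i, j, hij, heq⟩ := Finite.exists_ne_map_eq_of_infinite a
    rcases lt_or_gt_of_ne hij with hlt | hlt
    exacts [⟨j, i, hlt, id, Or.inl rfl, heq.symm⟩, ⟨i, j, hlt, id, Or.inl rfl, heq⟩]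
  obtain ⟨i, hi, φ, hφ, hai⟩ := Nat.find_spec hex
  have hmin : ∀ i j, i < j → j < Nat.find hex → ∀ ψ ∈ ({id, τ} : Set (V → V)), a j ≠ ψ (a i) :=
    fun i j hij hj ψ hψ heq => Nat.find_min hex hj ⟨i, hij, ψ, hψ, heq⟩
  obtain ⟨n, hn⟩ : ∃ n, Nat.find hex = n + 1 := ⟨Nat.find hex - 1, by omega⟩
  rw [hn] at hai hmin hi
  obtain rfl | ⟨l, rfl⟩ : i = 0 ∨ ∃ l, i = l + 1 := by cases i <;> simp
  · exact ⟨n, φ, hφ, hai, fun i j hij hj => hmin i j hij (by omega)⟩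
  exfalso
  have hφφ := h.involutive_of_mem hφ
  have hside := h.isSide_map_of_mem hφ (h.isSide_symm (ha.isSide n))
  rw [hai, hφφ] at hside
  rcases ha.eq_or_eq hside with heq | heq
  · exact hmin l n (by omega) (by omega) φ hφ (by rw [← heq, hφφ])
  · have heq' : a n = φ (a (l + 2)) := by rw [← heq, hφφ]
    rcases lt_trichotomy n (l + 2) with hlt | rfl | hgt
    · obtain rfl : n = l + 1 := by omega
      exact (ha.isSide (l + 1)).ne_of_mem hφ heq.symm
    · rcases hφ with rfl | rfl
      exacts [ha.ne (l + 1) hai, (h.adj _).ne heq']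
    · exact hmin (l + 2) n hgt (by omega) φ hφ heq'

end IsSideWalk

end Labelling

section Gluing

variable {V : Type*} {G : SimpleGraph V} {τ φ : V → V}

/-- The edges of the ladder with rungs `{a i, τ (a i)}`, `i ≤ n`, whose ends are glued by joining
`a n` to `φ (a 0)`. It is a band for `φ = id` and a Möbius band for `φ = τ`. -/
def gluedLadder (τ φ : V → V) (a : ℕ → V) (n : ℕ) : Set (Sym2 V) :=
  chainEdges (fun i : Fin (n + 1) => a i) (fun i => τ (a i)) ∪
    {s(a n, φ (a 0)), s(τ (a n), τ (φ (a 0)))}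

variable {a : ℕ → V} {n : ℕ}

theorem rung_mem_gluedLadder {i : ℕ} (hi : i ≤ n) : s(a i, τ (a i)) ∈ gluedLadder τ φ a n :=
  Or.inl (Or.inr ⟨⟨i, by omega⟩, rfl⟩)

theorem map_mem_gluedLadder (hτ : Function.Involutive τ) {e : Sym2 V}
    (he : e ∈ gluedLadder τ φ a n) : e.map τ ∈ gluedLadder τ φ a n := by
  rcases he with (⟨i, rfl | rfl⟩ | ⟨j, rfl⟩) | rfl | rfl
  · exact Or.inl (Or.inl ⟨i, Or.inr rfl⟩)
  · exact Or.inl (Or.inl ⟨i, Or.inl (by simp [hτ _])⟩)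
  · exact Or.inl (Or.inr ⟨j, by simp [hτ _, Sym2.eq_swap]⟩)
  · exact Or.inr (Or.inr rfl)
  · exact Or.inr (Or.inl (by simp [hτ _]))

theorem side_mem_gluedLadder (hret : a (n + 1) = φ (a 0)) {i : ℕ} (hi : i ≤ n) :
    s(a i, a (i + 1)) ∈ gluedLadder τ φ a n := by
  rcases hi.eq_or_lt with rfl | hi
  · exact Or.inr (Or.inl (by rw [hret]))
  · exact Or.inl (Or.inl ⟨⟨i, hi⟩, Or.inl rfl⟩)

variable (h : IsRungInvolution G τ) (hφ : φ ∈ ({id, τ} : Set (V → V)))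

include h hφ in
theorem exists_eq_of_mem_gluedLadder {x y : V} (hxy : s(x, y) ∈ gluedLadder τ φ a n) :
    ∃ i ≤ n, y = a i ∨ y = τ (a i) := by
  have hglue : φ (a 0) = a 0 ∨ φ (a 0) = τ (a 0) := by rcases hφ with rfl | rfl <;> simp
  rcases hxy with (⟨i, he | he⟩ | ⟨j, he⟩) | he | he <;>
    rcases Sym2.eq_iff.1 he with ⟨-, rfl⟩ | ⟨-, rfl⟩
  · exact ⟨i.succ, by omega, Or.inl rfl⟩
  · exact ⟨i.castSucc, by simp, Or.inl rfl⟩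
  · exact ⟨i.succ, by omega, Or.inr rfl⟩
  · exact ⟨i.castSucc, by simp, Or.inr rfl⟩
  · exact ⟨j, by omega, Or.inr rfl⟩
  · exact ⟨j, by omega, Or.inl rfl⟩
  · exact ⟨0, by omega, hglue⟩
  · exact ⟨n, le_rfl, Or.inl rfl⟩
  · refine ⟨0, by omega, ?_⟩
    rcases hglue with hg | hg <;> simp [hg, h.involutive _]
  · exact ⟨n, le_rfl, Or.inr rfl⟩

namespace IsSideWalk

variable (ha : IsSideWalk G τ a) (hret : a (n + 1) = φ (a 0))

include ha hret

omit hret in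
include h in
theorem gluedLadder_subset_edgeSet (hret : a (n + 1) = φ (a 0)) :
    gluedLadder τ φ a n ⊆ G.edgeSet := by
  have hlast := ha.isSide n
  rw [hret] at hlast
  rintro e ((⟨i, rfl | rfl⟩ | ⟨j, rfl⟩) | rfl | rfl)
  exacts [(ha.isSide i).1, (h.isSide_map (ha.isSide i)).1, h.adj _, hlast.1, (h.isSide_map hlast).1]

variable (hdist : ∀ i j, i < j → j ≤ n → ∀ ψ ∈ ({id, τ} : Set (V → V)), a j ≠ ψ (a i))

include h hφ hdist

/-- The walk continues after its first return as a copy of itself. -/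
theorem eq_map_one : a (n + 2) = φ (a 1) := by
  have hside := h.isSide_map_of_mem hφ (ha.isSide 0)
  rw [← hret] at hside
  refine ((ha.eq_or_eq hside).resolve_left fun heq => ?_).symm
  rcases lt_trichotomy n 1 with hn | rfl | hn
  · obtain rfl : n = 0 := by omega
    exact (ha.isSide 0).ne_of_mem hφ hret
  · rcases hφ with rfl | rfl
    exacts [ha.ne 0 hret, (h.adj _).ne' heq]
  · exact hdist 1 n hn le_rfl φ hφ heq.symm

theorem mem_gluedLadder_of_isSide {i : ℕ} (hi : i ≤ n) {y : V} (hs : IsSide G τ (a i) y) :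
    s(a i, y) ∈ gluedLadder τ φ a n := by
  cases i with
  | succ l =>
    rcases ha.eq_or_eq hs with rfl | rfl
    · rw [Sym2.eq_swap]
      exact side_mem_gluedLadder hret (by omega)
    · exact side_mem_gluedLadder hret hi
  | zero =>
    have hφφ := h.involutive_of_mem hφ
    have hs' := h.isSide_map_of_mem hφ hs
    rw [← hret] at hs'
    rcases ha.eq_or_eq hs' with heq | heq
    · rw [← hφφ y, heq]
      rcases hφ with rfl | rfl
      · exact Or.inr (Or.inl Sym2.eq_swap)
      · exact Or.inr (Or.inr (by rw [h.involutive, Sym2.eq_swap]; rfl))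
    · rw [ha.eq_map_one h hφ hret hdist] at heq
      rw [hφφ.injective heq]
      exact side_mem_gluedLadder hret hi

theorem mem_gluedLadder_of_adj {i : ℕ} (hi : i ≤ n) {x y : V} (hx : x = a i ∨ x = τ (a i))
    (hxy : G.Adj x y) : s(x, y) ∈ gluedLadder τ φ a n := by
  by_cases hy : y = τ x
  · subst hy
    rcases hx with rfl | rfl
    · exact rung_mem_gluedLadder hi
    · rw [h.involutive, Sym2.eq_swap]
      exact rung_mem_gluedLadder hi
  · rcases hx with rfl | rfl
    · exact ha.mem_gluedLadder_of_isSide h hφ hret hdist hi ⟨hxy, hy⟩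
    · have hside := h.isSide_map ⟨hxy, hy⟩
      rw [h.involutive] at hside
      have := map_mem_gluedLadder h.involutive
        (ha.mem_gluedLadder_of_isSide h hφ hret hdist hi hside)
      rwa [Sym2.map_mk, h.involutive] at this

theorem exists_eq_of_connected (hG : G.Connected) (x : V) : ∃ i ≤ n, x = a i ∨ x = τ (a i) := by
  by_contra hx
  obtain ⟨p⟩ := hG.preconnected (a 0) x
  obtain ⟨d, -, ⟨i, hi, hd⟩, hd'⟩ := p.exists_boundary_dart
    {x | ∃ i ≤ n, x = a i ∨ x = τ (a i)} ⟨0, by omega, Or.inl rfl⟩ hx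
  exact hd' (exists_eq_of_mem_gluedLadder h hφ
    (ha.mem_gluedLadder_of_adj h hφ hret hdist hi hd d.adj))

theorem edgeSet_eq_gluedLadder (hG : G.Connected) : G.edgeSet = gluedLadder τ φ a n := by
  refine Set.Subset.antisymm (fun e => ?_) (ha.gluedLadder_subset_edgeSet h hret)
  induction e using Sym2.ind with
  | _ x y =>
    obtain ⟨i, hi, hx⟩ := ha.exists_eq_of_connected h hφ hret hdist hG x
    exact ha.mem_gluedLadder_of_adj h hφ hret hdist hi hx

omit ha hret hφ in
theorem injective_sumElim : Function.Injective
    (Sum.elim (fun i : Fin (n + 1) => a i) (fun i : Fin (n + 1) => τ (a i))) := by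
  have hij : ∀ i j : Fin (n + 1), ∀ ψ ∈ ({id, τ} : Set (V → V)), a i = ψ (a j) → i = j := by
    intro i j ψ hψ heq
    rcases lt_trichotomy i j with hlt | rfl | hgt
    · exact absurd (by rw [heq, h.involutive_of_mem hψ]) (hdist i j hlt (by omega) ψ hψ)
    · rfl
    · exact absurd heq (hdist j i hgt (by omega) ψ hψ)
  have hne : ∀ i j : Fin (n + 1), a i ≠ τ (a j) := fun i j heq => by
    rw [hij i j τ (Or.inr rfl) heq] at heq
    exact (h.adj _).ne heq
  rintro (i | i) (j | j) heq
  · rw [hij i j id (Or.inl rfl) heq]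
  · exact absurd heq (hne i j)
  · exact absurd heq.symm (hne j i)
  · rw [hij i j id (Or.inl rfl) (h.involutive.injective heq)]

end IsSideWalk

omit hφ in
include h in
theorem IsRungInvolution.exists_isBand_or_isMobiusBand [Finite V] (hG : G.Connected) :
    ∃ (n : ℕ) (a b : Fin (n + 1) → V), IsBand G a b ∨ IsMobiusBand G a b := by
  obtain ⟨v⟩ := hG.nonempty
  obtain ⟨a, ha⟩ := h.exists_isSideWalk v
  obtain ⟨n, φ, hφ, hret, hdist⟩ := ha.exists_first_return h
  have hbij : Function.Bijective
      (Sum.elim (fun i : Fin (n + 1) => a i) fun i : Fin (n + 1) => τ (a i)) := by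
    refine ⟨IsSideWalk.injective_sumElim h hdist, fun x => ?_⟩
    obtain ⟨i, hi, rfl | rfl⟩ := ha.exists_eq_of_connected h hφ hret hdist hG x
    exacts [⟨Sum.inl ⟨i, by omega⟩, rfl⟩, ⟨Sum.inr ⟨i, by omega⟩, rfl⟩]
  have hE := ha.edgeSet_eq_gluedLadder h hφ hret hdist hG
  refine ⟨n, fun i => a i, fun i => τ (a i), ?_⟩
  rcases hφ with rfl | rfl
  · left
    refine ⟨hbij, ?_⟩
    rw [hE, gluedLadder, Sym2.eq_swap, Sym2.eq_swap (a := τ (a n))]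
    rfl
  · right
    refine ⟨hbij, ?_⟩
    rw [hE, gluedLadder, h.involutive, Sym2.eq_swap (a := φ (a n)), Set.pair_comm]
    rfl

end Gluing

section Parity

variable {V : Type*} {G : SimpleGraph V} {n : ℕ} {a b : Fin (n + 1) → V}

theorem exists_alternating_signs (hbij : Function.Bijective (Sum.elim a b)) :
    ∃ y : V → ℤ, (∀ i, y (a i) = (-1) ^ (i : ℕ)) ∧ (∀ i, y (b i) = -(-1) ^ (i : ℕ)) ∧
      ∀ v w, s(v, w) ∈ chainEdges a b → y v + y w = 0 := by
  let e := Equiv.ofBijective _ hbij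
  let y : V → ℤ := fun v => Sum.elim (fun i : Fin (n + 1) => (-1 : ℤ) ^ (i : ℕ))
    (fun i : Fin (n + 1) => -(-1 : ℤ) ^ (i : ℕ)) (e.symm v)
  have hya : ∀ i, y (a i) = (-1) ^ (i : ℕ) := fun i =>
    congrArg (Sum.elim _ _) (e.symm_apply_apply (Sum.inl i))
  have hyb : ∀ i, y (b i) = -(-1) ^ (i : ℕ) := fun i =>
    congrArg (Sum.elim _ _) (e.symm_apply_apply (Sum.inr i))
  refine ⟨y, hya, hyb, ?_⟩
  rintro v w (⟨i, hi | hi⟩ | ⟨j, hj⟩)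
  · rcases Sym2.eq_iff.1 hi with ⟨rfl, rfl⟩ | ⟨rfl, rfl⟩ <;> simp [hya, pow_succ]
  · rcases Sym2.eq_iff.1 hi with ⟨rfl, rfl⟩ | ⟨rfl, rfl⟩ <;> simp [hyb, pow_succ]
  · rcases Sym2.eq_iff.1 hj with ⟨rfl, rfl⟩ | ⟨rfl, rfl⟩ <;> simp [hya, hyb]

theorem IsBand.exists_signs (h : IsBand G a b) (hn : ¬Odd (n + 1)) :
    ∃ y : V → ℤ, y (a 0) = 1 ∧ ∀ v w, G.Adj v w → y v + y w = 0 := by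
  obtain ⟨y, hya, hyb, hy⟩ := exists_alternating_signs h.bijective
  have hpow : (-1 : ℤ) ^ n = -1 :=
    Odd.neg_one_pow (by rwa [Nat.odd_add_one, not_not] at hn)
  refine ⟨y, by simp [hya], fun v w hvw => ?_⟩
  have hmem : s(v, w) ∈ chainEdges a b ∪ _ := h.edgeSet_eq ▸ G.mem_edgeSet.2 hvw
  rcases hmem with hchain | hclose | hclose
  · exact hy v w hchain
  all_goals
    rcases Sym2.eq_iff.1 hclose with ⟨rfl, rfl⟩ | ⟨rfl, rfl⟩ <;> simp [hya, hyb, hpow]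

theorem IsMobiusBand.exists_signs (h : IsMobiusBand G a b) (hn : ¬Even (n + 1)) :
    ∃ y : V → ℤ, y (a 0) = 1 ∧ ∀ v w, G.Adj v w → y v + y w = 0 := by
  obtain ⟨y, hya, hyb, hy⟩ := exists_alternating_signs h.bijective
  have hpow : (-1 : ℤ) ^ n = 1 :=
    Even.neg_one_pow (by rwa [Nat.even_add_one, not_not] at hn)
  refine ⟨y, by simp [hya], fun v w hvw => ?_⟩
  have hmem : s(v, w) ∈ chainEdges a b ∪ _ := h.edgeSet_eq ▸ G.mem_edgeSet.2 hvw
  rcases hmem with hchain | hclose | hclose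
  · exact hy v w hchain
  all_goals
    rcases Sym2.eq_iff.1 hclose with ⟨rfl, rfl⟩ | ⟨rfl, rfl⟩ <;> simp [hya, hyb, hpow]

end Parity

section Components

open SimpleGraph.ConnectedComponent

variable {k : Type*} [Field k] {V : Type*} {G : SimpleGraph V} (c : G.ConnectedComponent)

theorem IsRungInvolution.exists_component {τ : V → V} (h : IsRungInvolution G τ) :
    ∃ τc : c → c, IsRungInvolution c.toSimpleGraph τc := by
  let τc : c → c := fun x => ⟨τ x, (mem_supp_congr_adj c (h.adj x)).1 x.2⟩
  have hside : ∀ v w : c, IsSide c.toSimpleGraph τc v w ↔ IsSide G τ v w := fun v w =>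
    and_congr Iff.rfl (not_congr Subtype.ext_iff)
  refine ⟨τc, fun x => h.adj x, fun x => Subtype.ext (h.involutive x),
    fun hvw => h.map_adj ((hside _ _).1 hvw), fun v => ?_⟩
  obtain ⟨p, q, hpq, hv⟩ := h.exists_sides v
  have hp := (mem_supp_congr_adj c ((hv p).2 (Or.inl rfl)).1).1 v.2
  have hq := (mem_supp_congr_adj c ((hv q).2 (Or.inr rfl)).1).1 v.2
  refine ⟨⟨p, hp⟩, ⟨q, hq⟩, fun heq => hpq (congrArg Subtype.val heq), fun w => ?_⟩
  rw [hside, hv, Subtype.ext_iff, Subtype.ext_iff]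

theorem exists_extension_of_component {y : c → ℤ}
    (hy : ∀ v w, c.toSimpleGraph.Adj v w → y v + y w = 0) :
    ∃ z : V → ℤ, (∀ v : c, z v = y v) ∧ ∀ v w, G.Adj v w → z v + z w = 0 := by
  classical
  refine ⟨fun v => if h : v ∈ c.supp then y ⟨v, h⟩ else 0, fun v => dif_pos v.2,
    fun v w hvw => ?_⟩
  have hiff := mem_supp_congr_adj c hvw
  by_cases hv : v ∈ c.supp
  · simpa only [dif_pos hv, dif_pos (hiff.1 hv)] using hy ⟨v, hv⟩ ⟨w, hiff.1 hv⟩ hvw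
  · simp only [dif_neg hv, dif_neg (mt hiff.2 hv), add_zero]

theorem isOddBand_or_isEvenMobiusBand_of_isCompleteIntersection [Fintype V] [DecidableRel G.Adj]
    (hG : G.IsRegularOfDegree 3) (hci : IsCompleteIntersection (graphIdeal k G)) :
    IsOddBand c.toSimpleGraph ∨ IsEvenMobiusBand c.toSimpleGraph := by
  obtain ⟨hrank, r, C, hC⟩ := exists_isFourCycleSystem_of_isCompleteIntersection hG hci
  obtain ⟨τ, hτ⟩ := hC.exists_isRungInvolution hG
  obtain ⟨τc, hτc⟩ := hτ.exists_component c
  have no_signs : ∀ v : c, ¬∃ y : c → ℤ, y v = 1 ∧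
      ∀ v w, c.toSimpleGraph.Adj v w → y v + y w = 0 := by
    rintro v ⟨y, hyv, hy⟩
    obtain ⟨z, hzy, hz⟩ := exists_extension_of_component c hy
    have hzv := congrFun (eq_zero_of_forall_adj_add_eq_zero hrank hz) v
    rw [hzy, hyv] at hzv
    exact one_ne_zero hzv
  obtain ⟨n, a, b, h | h⟩ := hτc.exists_isBand_or_isMobiusBand c.connected_toSimpleGraph
  · exact Or.inl ⟨n, a, b, by_contra fun hn => no_signs _ (h.exists_signs hn), h⟩
  · exact Or.inr ⟨n, a, b, by_contra fun hn => no_signs _ (h.exists_signs hn), h⟩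

end Components

section MinimalGeneratingSets

variable {R : Type*} [CommRing R] [IsNoetherianRing R] {I : Ideal R} {S : Set R}

/-- By Krull's height theorem no generating set of `I` has fewer than `I.height` elements. -/
theorem isMinimalGeneratingSet_of_encard_le_height (hI : I ≠ ⊤) (hS : Ideal.span S = I)
    (hcard : S.encard ≤ I.height) :
    IsMinimalGeneratingSet I S ∧ S.encard = I.height ∧ IsCompleteIntersection I := by
  have hkrull : I.height ≤ I.spanFinrank := Ideal.height_le_spanFinrank I hI
  have hspan : ∀ T, Ideal.span T = I → (I.spanFinrank : ℕ∞) ≤ T.encard := by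
    rintro T rfl
    exact Submodule.spanFinrank_span_le_encard T
  have hmin : ∀ T, Ideal.span T = I → S.encard ≤ T.encard := fun T hT =>
    (hcard.trans hkrull).trans (hspan T hT)
  have hfin : S.Finite := Set.finite_of_encard_le_coe (hcard.trans hkrull)
  refine ⟨⟨hS, fun T hT hTI => ?_, hmin⟩, hcard.antisymm (hkrull.trans (hspan S hS)),
    ((hspan S hS).trans hcard).antisymm hkrull⟩
  exact ((hfin.subset hT.subset).encard_lt_encard hT).not_ge (hmin T hTI)

end MinimalGeneratingSets

section Ladders

open MvPolynomial

variable {V : Type*}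

/-- `G` is a disjoint union of cyclic ladders without bipartite component, with rungs `{v, τ v}` and
sides `{v, σ v}`; `σ` moves one step along the ladder. The last condition says that walking around a
component takes an odd number of steps if it returns to the start, and an even number if it
returns to the other end of the rung. -/
structure IsLadder (G : SimpleGraph V) (σ τ : V → V) : Prop where
  bijective : Function.Bijective σ
  involutive : Function.Involutive τ
  comm : ∀ v, σ (τ v) = τ (σ v)
  adj_iff : ∀ v w, G.Adj v w ↔ w = τ v ∨ w = σ v ∨ v = σ w
  parity : ∀ v, ∃ r, (Odd r ∧ σ^[r] v = v) ∨ (Even r ∧ σ^[r] v = τ v)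

namespace IsLadder

variable {G : SimpleGraph V} {σ τ : V → V} (h : IsLadder G σ τ)

include h

theorem adj_rung (v : V) : G.Adj v (τ v) := (h.adj_iff v _).2 (.inl rfl)

theorem adj_side (v : V) : G.Adj v (σ v) := (h.adj_iff v _).2 (.inr (.inl rfl))

/-- The edge `{v, τ v}` of a ladder. -/
def rung (v : V) : G.edgeSet := ⟨s(v, τ v), h.adj_rung v⟩

/-- The edge `{v, σ v}` of a ladder. -/
def side (v : V) : G.edgeSet := ⟨s(v, σ v), h.adj_side v⟩

/-- The binomial of the 4-cycle through the rungs at `v` and at `σ v`. -/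
noncomputable def quadric (k : Type*) [Field k] (v : V) :
    MvPolynomial G.edgeSet k :=
  binomial k (.single (h.rung v) 1 + .single (h.rung (σ v)) 1)
    (.single (h.side v) 1 + .single (h.side (τ v)) 1)

theorem adj_apply_iff (v w : V) : G.Adj (σ v) w ↔ w = τ (σ v) ∨ w = σ (σ v) ∨ w = v := by
  rw [h.adj_iff, h.bijective.injective.eq_iff, eq_comm (a := v)]

theorem rung_apply (v : V) : h.rung (τ v) = h.rung v :=
  Subtype.ext (by simp only [rung, h.involutive v, Sym2.eq_swap])

theorem exists_eq_rung_or_side (e : G.edgeSet) : (∃ v, e = h.rung v) ∨ ∃ v, e = h.side v := by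
  obtain ⟨e, he⟩ := e
  induction e using Sym2.ind with
  | _ v w =>
    rcases (h.adj_iff v w).1 he with rfl | rfl | rfl
    · exact .inl ⟨v, rfl⟩
    · exact .inr ⟨v, rfl⟩
    · exact .inr ⟨w, Subtype.ext Sym2.eq_swap⟩

section Quadrics

variable (k : Type*) [Field k]

theorem quadric_isHomogeneous (v : V) : (h.quadric k v).IsHomogeneous 2 :=
  (isHomogeneous_monomial 1 (by simp)).sub (isHomogeneous_monomial 1 (by simp))

theorem quadric_apply (v : V) : h.quadric k (τ v) = h.quadric k v := by
  rw [quadric, quadric, h.comm, h.rung_apply, h.rung_apply, h.involutive v,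
    add_comm (Finsupp.single (h.side v) 1)]

theorem two_mul_ncard_range_quadric_le [Fintype V] :
    2 * (Set.range (h.quadric k)).ncard ≤ Fintype.card V := by
  classical
  rw [← Set.image_univ, ← Finset.coe_univ, ← Finset.coe_image, Set.ncard_coe_finset,
    ← Finset.card_univ, Finset.card_eq_sum_card_image (h.quadric k) Finset.univ, mul_comm]
  refine Finset.card_nsmul_le_sum _ _ 2 fun f hf => ?_
  obtain ⟨v, -, rfl⟩ := Finset.mem_image.1 hf
  refine Finset.one_lt_card.2 ⟨v, by simp, τ v, ?_, (h.adj_rung v).ne⟩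
  simp [h.quadric_apply]

theorem quadric_mem_toricIdeal [Fintype V] (v : V) :
    h.quadric k v ∈ toricIdeal k (incidence G) := by
  have := Fintype.ofFinite G.edgeSet
  have hopp : G.Adj (τ v) (τ (σ v)) := h.comm v ▸ h.adj_side (τ v)
  have hside : h.side (τ v) = ⟨s(τ v, τ (σ v)), hopp⟩ :=
    Subtype.ext (by simp only [side, h.comm])
  have hrung : h.rung (σ v) = ⟨s(τ (σ v), σ v), (h.adj_rung _).symm⟩ := Subtype.ext Sym2.eq_swap
  rw [quadric, binomial_mem_toricIdeal, hside, hrung]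
  exact mulVec_incidence_square (h.adj_rung v) hopp (h.adj_rung _).symm (h.adj_side v)

end Quadrics

section Cubic

variable [Fintype V] [DecidableRel G.Adj] (hG : G.IsRegularOfDegree 3)

include hG

theorem neighbors_ne (v : V) : τ (σ v) ≠ σ (σ v) ∧ τ (σ v) ≠ v ∧ σ (σ v) ≠ v := by
  classical
  have hsub : G.neighborFinset (σ v) ⊆ {τ (σ v), σ (σ v), v} := by
    intro w hw
    simpa [h.adj_apply_iff] using hw
  have hcard := Finset.card_le_card hsub
  rw [G.card_neighborFinset_eq_degree, hG.degree_eq] at hcard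
  have hpair : ∀ x y : V, ({x, y} : Finset V).card ≤ 2 := fun _ _ => Finset.card_le_two
  refine ⟨fun heq => ?_, fun heq => ?_, fun heq => ?_⟩
  · rw [heq, Finset.insert_eq_of_mem (by simp)] at hcard
    exact absurd (hcard.trans (hpair _ _)) (by omega)
  · rw [heq, Finset.insert_eq_of_mem (by simp)] at hcard
    exact absurd (hcard.trans (hpair _ _)) (by omega)
  · rw [heq, Finset.pair_eq_singleton] at hcard
    exact absurd (hcard.trans (hpair _ _)) (by omega)

theorem apply_ne_apply (v : V) : τ v ≠ σ v := by
  obtain ⟨w, rfl⟩ := h.bijective.surjective v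
  exact (h.neighbors_ne hG w).1

theorem side_ne_side (v : V) : h.side v ≠ h.side (τ v) := by
  intro heq
  rcases Sym2.eq_iff.1 (Subtype.ext_iff.1 heq) with ⟨hv, -⟩ | ⟨-, hv⟩
  · exact (h.adj_rung v).ne hv
  · exact h.apply_ne_apply hG v hv.symm

theorem rung_ne_side (v w : V) : h.rung v ≠ h.side w := by
  intro heq
  rcases Sym2.eq_iff.1 (Subtype.ext_iff.1 heq) with ⟨rfl, hv⟩ | ⟨rfl, hv⟩
  · exact h.apply_ne_apply hG v hv
  · exact (h.neighbors_ne hG w).2.1 hv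

/-- Replacing opposite sides of a square by its rungs lowers the number of sides of a monomial. -/
theorem exists_reduced (k : Type*) [Field k] (α : G.edgeSet →₀ ℕ) :
    ∃ β : G.edgeSet →₀ ℕ, (∀ v, β (h.side v) = 0 ∨ β (h.side (τ v)) = 0) ∧
      binomial k α β ∈ Ideal.span (Set.range (h.quadric k)) := by
  classical
  induction hα : ∑ v, α (h.side v) using Nat.strong_induction_on generalizing α with
  | _ N ih =>
    by_cases hred : ∀ v, α (h.side v) = 0 ∨ α (h.side (τ v)) = 0
    · exact ⟨α, hred, by simp [binomial_self]⟩
    push Not at hred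
    obtain ⟨v, hv, hτv⟩ := hred
    obtain ⟨γ, rfl⟩ := exists_add_of_le (single_add_single_le (h.side_ne_side hG v) hv hτv)
    have hlt : ∑ w, (.single (h.rung v) 1 + .single (h.rung (σ v)) 1 + γ :
        G.edgeSet →₀ ℕ) (h.side w) < N := by
      rw [← hα]
      refine Finset.sum_lt_sum (fun w _ => ?_) ⟨v, Finset.mem_univ v, ?_⟩ <;>
        simp [Finsupp.single_apply, h.rung_ne_side hG]
    obtain ⟨β, hβ, hmem⟩ := ih _ hlt _ rfl
    refine ⟨β, hβ, ?_⟩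
    have hquadric : monomial γ 1 * h.quadric k v ∈ Ideal.span (Set.range (h.quadric k)) :=
      Ideal.mul_mem_left _ _ (Ideal.subset_span ⟨v, rfl⟩)
    rw [quadric, monomial_mul_binomial, add_comm γ, add_comm γ] at hquadric
    have := sub_mem hmem hquadric
    rwa [binomial, binomial, sub_sub_sub_cancel_left] at this

variable [Fintype G.edgeSet] {u : G.edgeSet → ℤ} (hu : u ∈ relationLattice (incidence G))

include hu

theorem rung_add_side_add_side (v : V) :
    u (h.rung (σ v)) + u (h.side (σ v)) + u (h.side v) = 0 := by
  classical
  obtain ⟨hrs, hrv, hsv⟩ := h.neighbors_ne hG v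
  have hsum := mem_relationLattice_incidence.1 hu (σ v)
  rw [← Finset.sum_subset (Finset.subset_univ {τ (σ v), σ (σ v), v}) fun w _ hw => ?_] at hsum
  · rw [Finset.sum_insert (by simp [hrs, hrv]), Finset.sum_pair hsv, ← add_assoc,
      edgeExtend_of_mem u (h.adj_rung _), edgeExtend_of_mem u (h.adj_side _),
      edgeExtend_of_mem u (h.adj_side v).symm] at hsum
    rwa [show h.side v = ⟨s(σ v, v), (h.adj_side v).symm⟩ from Subtype.ext Sym2.eq_swap]
  · refine not_imp_comm.1 mem_edgeSet_of_edgeExtend_ne_zero fun hadj => hw ?_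
    simpa using (h.adj_apply_iff v w).1 hadj

theorem side_sub_side_iterate (r : ℕ) (v : V) :
    u (h.side (σ^[r] v)) - u (h.side (τ (σ^[r] v))) =
      (-1) ^ r * (u (h.side v) - u (h.side (τ v))) := by
  induction r with
  | zero => simp
  | succ r ih =>
    have hv := h.rung_add_side_add_side hG hu (σ^[r] v)
    have hτv := h.rung_add_side_add_side hG hu (τ (σ^[r] v))
    rw [h.comm, h.rung_apply] at hτv
    rw [Function.iterate_succ_apply', pow_succ, mul_neg_one, neg_mul, ← ih]
    linarith

theorem side_eq_side (v : V) : u (h.side v) = u (h.side (τ v)) := by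
  obtain ⟨r, ⟨hr, hv⟩ | ⟨hr, hv⟩⟩ := h.parity v
  all_goals
    have hiter := h.side_sub_side_iterate hG hu r v
    rw [hv, hr.neg_one_pow] at hiter
  · linarith
  · rw [h.involutive v] at hiter
    linarith

theorem eq_zero_of_side_eq_zero (hside : ∀ v, u (h.side v) = 0) : u = 0 := by
  ext e
  rcases h.exists_eq_rung_or_side e with ⟨v, rfl⟩ | ⟨v, rfl⟩
  · obtain ⟨w, rfl⟩ := h.bijective.surjective v
    simpa only [hside, add_zero, Pi.zero_apply] using h.rung_add_side_add_side hG hu w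
  · exact hside v

omit hu [Fintype G.edgeSet]

variable (k : Type*) [Field k]

theorem span_range_quadric :
    Ideal.span (Set.range (h.quadric k)) = toricIdeal k (incidence G) := by
  have hle : Ideal.span (Set.range (h.quadric k)) ≤ toricIdeal k (incidence G) := by
    rw [Ideal.span_le]
    rintro _ ⟨v, rfl⟩
    exact h.quadric_mem_toricIdeal k v
  refine le_antisymm hle ?_
  have := Fintype.ofFinite G.edgeSet
  rw [← span_toricBinomials, Ideal.span_le]
  rintro _ ⟨α, β, hαβ, rfl⟩
  obtain ⟨α', hα', hαα'⟩ := h.exists_reduced hG k α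
  obtain ⟨β', hβ', hββ'⟩ := h.exists_reduced hG k β
  have hu : expDiff α' β' ∈ relationLattice (incidence G) :=
    expDiff_mem_relationLattice.2 <| (binomial_mem_toricIdeal.1 (hle hαα')).symm.trans <|
      hαβ.trans (binomial_mem_toricIdeal.1 (hle hββ'))
  have hzero : expDiff α' β' = 0 := by
    refine h.eq_zero_of_side_eq_zero hG hu fun v => ?_
    have hside := h.side_eq_side hG hu v
    have hαv := hα' v
    have hβv := hβ' v
    simp only [expDiff] at hside ⊢
    omega
  obtain rfl : α' = β' := by
    simpa using expDiff_eq_expDiff_iff.1 (hzero.trans (expDiff_self 0).symm)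
  have := sub_mem hαα' hββ'
  rwa [binomial, binomial, sub_sub_sub_cancel_right] at this

theorem isMinimalGeneratingSet :
    IsMinimalGeneratingSet (graphIdeal k G) (Set.range (h.quadric k)) ∧
      2 * (Set.range (h.quadric k)).ncard = Fintype.card V ∧
      IsCompleteIntersection (graphIdeal k G) := by
  have := Fintype.ofFinite G.edgeSet
  have hheight : (graphIdeal k G).height = Module.finrank ℤ (relationLattice (incidence G)) :=
    height_toricIdeal _
  have hfin : (Set.range (h.quadric k)).Finite := Set.finite_range _
  have hquadrics := h.two_mul_ncard_range_quadric_le k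
  have hedges := three_mul_card_eq hG
  have hrank := card_edgeSet_le_finrank_add (G := G)
  obtain ⟨hmin, hcard, hci⟩ := isMinimalGeneratingSet_of_encard_le_height
    (toricIdeal_isPrime (incidence G)).ne_top (h.span_range_quadric hG k) (by
      rw [← hfin.cast_ncard_eq]
      exact (Nat.cast_le.2 (by omega)).trans hheight.ge)
  refine ⟨hmin, ?_, hci⟩
  have : (Set.range (h.quadric k)).ncard = Module.finrank ℤ (relationLattice (incidence G)) := by
    exact_mod_cast hfin.cast_ncard_eq.trans (hcard.trans hheight)
  omega

end Cubic

end IsLadder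

end Ladders

section BandShifts

variable {V : Type*} {n : ℕ}

/-- `τ` swaps the ends `a i`, `b i` of the rungs of a chain, and `σ` moves both of them one step
along the chain. The value of `σ` at the last rung, which distinguishes bands from Möbius bands, is
left open. -/
structure IsBandShift (a b : Fin (n + 1) → V) (σ τ : V → V) : Prop where
  involutive : Function.Involutive τ
  comm : Function.Commute σ τ
  rung : ∀ i, τ (a i) = b i
  shift : ∀ i : Fin n, σ (a i.castSucc) = a i.succ

variable {a b : Fin (n + 1) → V} {σ τ φ : V → V}

theorem exists_isBandShift (hbij : Function.Bijective (Sum.elim a b)) {p : V}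
    (hp : p = a 0 ∨ p = b 0) :
    ∃ σ τ : V → V, Function.Bijective σ ∧ IsBandShift a b σ τ ∧ σ (a (Fin.last n)) = p := by
  let e : Fin (n + 1) × Bool ≃ V :=
    ((Equiv.prodComm _ _).trans (Equiv.boolProdEquivSum _)).trans (Equiv.ofBijective _ hbij)
  have hea : ∀ i, e.symm (a i) = (i, false) := fun i => e.symm_apply_eq.2 rfl
  obtain ⟨t, rfl⟩ : ∃ t, e (0, t) = p := by
    rcases hp with rfl | rfl
    exacts [⟨false, rfl⟩, ⟨true, rfl⟩]
  let twist : Fin (n + 1) → Equiv.Perm Bool := fun i =>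
    if i = Fin.last n ∧ t then Equiv.boolNot else Equiv.refl _
  have htwist : ∀ i x, twist i (!x) = !twist i x := fun i x => by
    simp only [twist]
    split_ifs <;> simp
  refine ⟨(e.symm.trans ((finRotate (n + 1)).prodShear twist)).trans e,
    (e.symm.trans (Equiv.prodCongr (Equiv.refl _) Equiv.boolNot)).trans e, Equiv.bijective _,
    ⟨fun v => ?_, fun v => ?_, fun i => ?_, fun i => ?_⟩, ?_⟩
  · simp [Prod.map]
  · simp [htwist]
  · simp only [Equiv.trans_apply, hea]
    rfl
  · simp only [Equiv.trans_apply, hea]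
    simp [twist, (Fin.castSucc_lt_last i).ne, e, Equiv.boolProdEquivSum]
  · simp only [Equiv.trans_apply, hea]
    cases t <;> simp [twist]

namespace IsBandShift

variable (h : IsBandShift a b σ τ)

include h

theorem rung_symm (i : Fin (n + 1)) : τ (b i) = a i := by
  rw [← h.rung, h.involutive]

theorem shift_rung (i : Fin n) : σ (b i.castSucc) = b i.succ := by
  rw [← h.rung, h.comm, h.shift, h.rung]

theorem apply_rung (i : Fin (n + 1)) : σ (b i) = τ (σ (a i)) := by
  rw [← h.rung, h.comm]

theorem iterate_apply_zero (i : Fin (n + 1)) : σ^[i] (a 0) = a i := by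
  induction i using Fin.induction with
  | zero => rfl
  | succ i ih => rw [Fin.val_succ, Function.iterate_succ_apply', ← Fin.val_castSucc, ih, h.shift]

variable (hsurj : Function.Surjective (Sum.elim a b))

include hsurj

/-- The vertex `a 0` generates all others under `σ` and `τ`, so `σ^[n + 1]` is determined by its
value there. -/
theorem iterate_eq (hσ : Function.Commute φ σ) (hτ : Function.Commute φ τ)
    (hlast : σ (a (Fin.last n)) = φ (a 0)) (v : V) : σ^[n + 1] v = φ v := by
  have ha : ∀ i, σ^[n + 1] (a i) = φ (a i) := fun i => by
    rw [← h.iterate_apply_zero, (Function.Commute.iterate_iterate_self σ (n + 1) i).eq,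
      Function.iterate_succ_apply', show σ^[n] (a 0) = _ from h.iterate_apply_zero (Fin.last n),
      hlast, (hσ.iterate_right i).eq]
  obtain ⟨i | i, rfl⟩ := hsurj v
  · exact ha i
  · rw [Sum.elim_inr, ← h.rung, (h.comm.iterate_left _).eq, ha, hτ.eq]

theorem mem_edges_iff {e : Sym2 V} :
    e ∈ chainEdges a b ∪
        {s(a (Fin.last n), σ (a (Fin.last n))), s(b (Fin.last n), σ (b (Fin.last n)))} ↔
      (∃ v, e = s(v, τ v)) ∨ ∃ v, e = s(v, σ v) := by
  constructor
  · rintro ((⟨i, rfl | rfl⟩ | ⟨i, rfl⟩) | rfl | rfl)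
    · exact .inr ⟨_, by rw [h.shift]⟩
    · exact .inr ⟨_, by rw [h.shift_rung]⟩
    · exact .inl ⟨_, by rw [h.rung]⟩
    · exact .inr ⟨_, rfl⟩
    · exact .inr ⟨_, rfl⟩
  · rintro (⟨v, rfl⟩ | ⟨v, rfl⟩) <;> obtain ⟨i | i, rfl⟩ := hsurj v
    · exact .inl (.inr ⟨i, by rw [Sum.elim_inl, h.rung]⟩)
    · exact .inl (.inr ⟨i, by rw [Sum.elim_inr, h.rung_symm, Sym2.eq_swap]⟩)
    · induction i using Fin.lastCases with
      | cast i => exact .inl (.inl ⟨i, .inl (by rw [Sum.elim_inl, h.shift])⟩)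
      | last => exact .inr (.inl rfl)
    · induction i using Fin.lastCases with
      | cast i => exact .inl (.inl ⟨i, .inr (by rw [Sum.elim_inr, h.shift_rung])⟩)
      | last => exact .inr (.inr rfl)

theorem isLadder {G : SimpleGraph V} (hσ : Function.Bijective σ)
    (hE : G.edgeSet = chainEdges a b ∪
      {s(a (Fin.last n), σ (a (Fin.last n))), s(b (Fin.last n), σ (b (Fin.last n)))})
    (hparity : ∀ v, ∃ r, (Odd r ∧ σ^[r] v = v) ∨ (Even r ∧ σ^[r] v = τ v)) :
    IsLadder G σ τ where
  bijective := hσ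
  involutive := h.involutive
  comm := h.comm
  parity := hparity
  adj_iff v w := by
    rw [← SimpleGraph.mem_edgeSet, hE, h.mem_edges_iff hsurj]
    constructor
    · rintro (⟨x, hx⟩ | ⟨x, hx⟩) <;> rcases Sym2.eq_iff.1 hx with ⟨rfl, rfl⟩ | ⟨rfl, rfl⟩
      exacts [.inl rfl, .inl (h.involutive w).symm, .inr (.inl rfl), .inr (.inr rfl)]
    · rintro (rfl | rfl | rfl)
      exacts [.inl ⟨v, rfl⟩, .inr ⟨v, rfl⟩, .inr ⟨w, Sym2.eq_swap⟩]

end IsBandShift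

theorem IsBand.exists_isLadder {G : SimpleGraph V} (h : IsBand G a b) (hn : Odd (n + 1)) :
    ∃ σ τ, IsLadder G σ τ ∧ IsBandShift a b σ τ ∧ σ (a (Fin.last n)) = a 0 := by
  obtain ⟨σ, τ, hσ, hs, hlast⟩ := exists_isBandShift h.bijective (.inl rfl)
  refine ⟨σ, τ, hs.isLadder h.bijective.surjective hσ ?_ fun v => ⟨n + 1, .inl ⟨hn, ?_⟩⟩, hs, hlast⟩
  · rw [hs.apply_rung, hlast, hs.rung, h.edgeSet_eq, Sym2.eq_swap, Sym2.eq_swap (a := b 0)]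
  · exact hs.iterate_eq h.bijective.surjective (.id_left) (.id_left) hlast v

theorem IsMobiusBand.exists_isLadder {G : SimpleGraph V} (h : IsMobiusBand G a b)
    (hn : Even (n + 1)) :
    ∃ σ τ, IsLadder G σ τ ∧ IsBandShift a b σ τ ∧ σ (a (Fin.last n)) = b 0 := by
  obtain ⟨σ, τ, hσ, hs, hlast⟩ := exists_isBandShift h.bijective (.inr rfl)
  refine ⟨σ, τ, hs.isLadder h.bijective.surjective hσ ?_ fun v => ⟨n + 1, .inr ⟨hn, ?_⟩⟩, hs, hlast⟩
  · rw [hs.apply_rung, hlast, hs.rung_symm, h.edgeSet_eq, Sym2.eq_swap, Set.pair_comm]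
  · have hlast' : σ (a (Fin.last n)) = τ (a 0) := hlast.trans (hs.rung 0).symm
    exact hs.iterate_eq h.bijective.surjective hs.comm.symm (.refl τ) hlast' v

end BandShifts

section Walks

open MvPolynomial

variable (k : Type*) [Field k] {V : Type*} {G : SimpleGraph V}

theorem exists_walkBinomial_iff {p q r s : V} (hpq : G.Adj p q) (hqr : G.Adj q r)
    (hrs : G.Adj r s) (hsp : G.Adj s p) {f : MvPolynomial G.edgeSet k} :
    (∃ (u : V) (w : G.Walk u u), f = walkBinomial k w ∧ w.support = [p, q, r, s, p]) ↔
      f = X ⟨s(p, q), hpq⟩ * X ⟨s(r, s), hrs⟩ - X ⟨s(q, r), hqr⟩ * X ⟨s(s, p), hsp⟩ := by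
  constructor
  · rintro ⟨u, w, rfl, hw⟩
    rcases w with - | ⟨h₁, - | ⟨h₂, - | ⟨h₃, - | ⟨h₄, - | ⟨h₅, w⟩⟩⟩⟩⟩ <;>
      simp only [SimpleGraph.Walk.support_cons, SimpleGraph.Walk.support_nil, List.cons.injEq,
        SimpleGraph.Walk.support_ne_nil, reduceCtorEq, and_false, and_true] at hw
    obtain ⟨rfl, rfl, rfl, rfl, -⟩ := hw
    simp [walkBinomial, walkMonomials]
  · rintro rfl
    exact ⟨p, .cons hpq (.cons hqr (.cons hrs (.cons hsp .nil))), by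
      simp [walkBinomial, walkMonomials], rfl⟩

namespace IsLadder

variable {σ τ : V → V} (h : IsLadder G σ τ)

include h

theorem quadric_eq (v : V) : h.quadric k v =
    X (h.rung v) * X (h.rung (σ v)) - X (h.side v) * X (h.side (τ v)) := by
  simp [quadric, binomial, X, monomial_mul]

theorem exists_walkBinomial_iff (v : V) {f : MvPolynomial G.edgeSet k} :
    (∃ (u : V) (w : G.Walk u u), f = walkBinomial k w ∧
      w.support = [v, τ v, τ (σ v), σ v, v]) ↔ f = h.quadric k v := by
  have hopp : G.Adj (τ v) (τ (σ v)) := h.comm v ▸ h.adj_side (τ v)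
  rw [ToricGraph.exists_walkBinomial_iff k (h.adj_rung v) hopp (h.adj_rung _).symm
    (h.adj_side v).symm, quadric_eq, mul_comm (X (h.side v))]
  simp only [rung, side, h.comm, Sym2.eq_swap (a := τ (σ v)), Sym2.eq_swap (a := σ v) (b := v)]

theorem exists_walkBinomial_reverse_iff (v : V) {f : MvPolynomial G.edgeSet k} :
    (∃ (u : V) (w : G.Walk u u), f = walkBinomial k w ∧
      w.support = [σ v, τ (σ v), τ v, v, σ v]) ↔ f = h.quadric k v := by
  have hopp : G.Adj (τ v) (τ (σ v)) := h.comm v ▸ h.adj_side (τ v)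
  rw [ToricGraph.exists_walkBinomial_iff k (h.adj_rung _) hopp.symm (h.adj_rung v).symm
    (h.adj_side v), quadric_eq, mul_comm (X (h.rung v)), mul_comm (X (h.side v))]
  simp only [rung, side, h.comm, Sym2.eq_swap (a := τ v) (b := v),
    Sym2.eq_swap (a := τ (σ v)) (b := τ v)]

variable {n : ℕ} {a b : Fin (n + 1) → V} (hs : IsBandShift a b σ τ)

include hs

/-- The last of the walks starts with the end of the square at `d`, which is `a n` or `b n`. -/
theorem setOf_walkBinomial_eq_image {d : V} (hd : σ d = a 0)
    (hlast : d = a (Fin.last n) ∨ d = b (Fin.last n)) :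
    {f | ∃ (u : V) (w : G.Walk u u), f = walkBinomial k w ∧
      ((∃ i : Fin n, w.support = [a i.castSucc, b i.castSucc, b i.succ, a i.succ, a i.castSucc]) ∨
        w.support = [a 0, b 0, τ d, d, a 0])} =
      h.quadric k '' Set.range (Sum.elim a b) := by
  have hchain : ∀ i : Fin n, [a i.castSucc, b i.castSucc, b i.succ, a i.succ, a i.castSucc] =
      [a i.castSucc, τ (a i.castSucc), τ (σ (a i.castSucc)), σ (a i.castSucc), a i.castSucc] :=
    fun i => by rw [hs.rung, hs.shift, hs.rung]
  have hclose : [a 0, b 0, τ d, d, a 0] = [σ d, τ (σ d), τ d, d, σ d] := by rw [hd, hs.rung]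
  have hrung : ∀ i, h.quadric k (b i) = h.quadric k (a i) := fun i => by
    rw [← hs.rung, h.quadric_apply]
  have hquadric : h.quadric k d = h.quadric k (a (Fin.last n)) := by
    rcases hlast with rfl | rfl
    exacts [rfl, hrung _]
  ext f
  constructor
  · rintro ⟨u, w, hf, ⟨i, hw⟩ | hw⟩
    · exact ⟨_, ⟨.inl i.castSucc, rfl⟩,
        ((h.exists_walkBinomial_iff k _).1 ⟨u, w, hf, hw.trans (hchain i)⟩).symm⟩
    · exact ⟨_, ⟨.inl (Fin.last n), rfl⟩, hquadric.symm.trans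
        ((h.exists_walkBinomial_reverse_iff k _).1 ⟨u, w, hf, hw.trans hclose⟩).symm⟩
  · rintro ⟨_, ⟨x, rfl⟩, rfl⟩
    obtain ⟨i, hi⟩ : ∃ i, h.quadric k (Sum.elim a b x) = h.quadric k (a i) := by
      rcases x with i | i
      exacts [⟨i, rfl⟩, ⟨i, hrung i⟩]
    rw [hi]
    induction i using Fin.lastCases with
    | cast i =>
      obtain ⟨u, w, hf, hw⟩ := (h.exists_walkBinomial_iff k (a i.castSucc)).2 rfl
      exact ⟨u, w, hf, .inl ⟨i, hw.trans (hchain i).symm⟩⟩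
    | last =>
      rw [← hquadric]
      obtain ⟨u, w, hf, hw⟩ := (h.exists_walkBinomial_reverse_iff k d).2 rfl
      exact ⟨u, w, hf, .inr (hw.trans hclose.symm)⟩

theorem bandQuadrics_eq_image (hlast : σ (a (Fin.last n)) = a 0) :
    bandQuadrics k G a b = h.quadric k '' Set.range (Sum.elim a b) := by
  rw [← h.setOf_walkBinomial_eq_image k hs hlast (.inl rfl), hs.rung]
  rfl

theorem mobiusQuadrics_eq_image (hlast : σ (a (Fin.last n)) = b 0) :
    mobiusQuadrics k G a b = h.quadric k '' Set.range (Sum.elim a b) := by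
  rw [← h.setOf_walkBinomial_eq_image k hs (d := b (Fin.last n)) ?_ (.inr rfl), hs.rung_symm]
  · rfl
  · rw [hs.apply_rung, hlast, hs.rung_symm]

end IsLadder

end Walks

section Components

variable {V : Type*} {G : SimpleGraph V}

/-- The map on the vertices of `G` that restricts to `f c` on each component `c`. -/
def glue (f : ∀ c : G.ConnectedComponent, c → c) (v : V) : V :=
  f (G.connectedComponentMk v) ⟨v, rfl⟩

theorem glue_coe (f : ∀ c : G.ConnectedComponent, c → c) {c : G.ConnectedComponent} (x : c) :
    glue f x = f c x := by
  obtain ⟨v, rfl⟩ := x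
  rfl

theorem glue_iterate_coe (f : ∀ c : G.ConnectedComponent, c → c) {c : G.ConnectedComponent}
    (x : c) (r : ℕ) : (glue f)^[r] x = ((f c)^[r] x : c) := by
  induction r with
  | zero => rfl
  | succ r ih => rw [Function.iterate_succ_apply', Function.iterate_succ_apply', ih, glue_coe]

theorem exists_eq_coe_component (v : V) : ∃ (c : G.ConnectedComponent) (x : c), v = x :=
  ⟨G.connectedComponentMk v, ⟨v, rfl⟩, rfl⟩

theorem bijective_glue {f : ∀ c : G.ConnectedComponent, c → c}
    (hf : ∀ c, Function.Bijective (f c)) : Function.Bijective (glue f) := by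
  choose g hgf hfg using fun c => Function.bijective_iff_has_inverse.1 (hf c)
  refine Function.bijective_iff_has_inverse.2 ⟨glue g, fun v => ?_, fun v => ?_⟩ <;>
    obtain ⟨c, x, rfl⟩ := exists_eq_coe_component (G := G) v
  · rw [glue_coe, glue_coe, hgf]
  · rw [glue_coe, glue_coe, hfg]

variable {σ τ : ∀ c : G.ConnectedComponent, c → c}

theorem isLadder_glue (h : ∀ c, IsLadder c.toSimpleGraph (σ c) (τ c)) :
    IsLadder G (glue σ) (glue τ) := by
  refine ⟨bijective_glue fun c => (h c).bijective, fun v => ?_, fun v => ?_, fun v w => ?_,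
    fun v => ?_⟩ <;> obtain ⟨c, x, rfl⟩ := exists_eq_coe_component (G := G) v
  · rw [glue_coe, glue_coe, (h c).involutive]
  · simp only [glue_coe, (h c).comm]
  · constructor
    · intro hadj
      have hw : w ∈ c.supp := (c.mem_supp_congr_adj hadj).1 x.2
      lift w to c using hw
      simpa only [glue_coe, Subtype.coe_inj] using ((h c).adj_iff x w).1 hadj
    · rintro (rfl | rfl | hx)
      · rw [glue_coe]
        exact (h c).adj_rung x
      · rw [glue_coe]
        exact (h c).adj_side x
      · obtain ⟨d, y, rfl⟩ := exists_eq_coe_component (G := G) w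
        rw [hx, glue_coe]
        exact ((h d).adj_side y).symm
  · obtain ⟨r, hr⟩ := (h c).parity x
    exact ⟨r, by simpa only [glue_iterate_coe, glue_coe, Subtype.coe_inj] using hr⟩

variable {c : G.ConnectedComponent} {n : ℕ} {a b : Fin (n + 1) → c}

theorem IsBandShift.glue (hl : IsLadder G (glue σ) (glue τ)) (h : IsBandShift a b (σ c) (τ c)) :
    IsBandShift (fun i => (a i : V)) (fun i => (b i : V)) (glue σ) (glue τ) where
  involutive := hl.involutive
  comm := hl.comm
  rung i := by rw [glue_coe, h.rung]
  shift i := by rw [glue_coe, h.shift]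

theorem range_sumElim_coe (hsurj : Function.Surjective (Sum.elim a b)) :
    Set.range (Sum.elim (fun i => (a i : V)) (fun i => (b i : V))) = c.supp := by
  have : Sum.elim (fun i => (a i : V)) (fun i => (b i : V)) = Subtype.val ∘ Sum.elim a b :=
    (Sum.comp_elim _ _ _).symm
  rw [this, hsurj.range_comp]
  exact Subtype.range_val

variable {k : Type*} [Field k]

theorem IsComponentQuadrics.exists_isLadder {c : G.ConnectedComponent}
    {S : Set (MvPolynomial G.edgeSet k)} (hS : IsComponentQuadrics k c S) :
    ∃ σc τc : c → c, IsLadder c.toSimpleGraph σc τc ∧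
      ∀ {σ τ} (h : IsLadder G (ToricGraph.glue σ) (ToricGraph.glue τ)), σ c = σc → τ c = τc →
        S = h.quadric k '' c.supp := by
  obtain ⟨n, a, b, ⟨hn, hb, rfl⟩ | ⟨hn, hb, rfl⟩⟩ := hS <;>
    obtain ⟨σc, τc, hl, hs, hlast⟩ := hb.exists_isLadder hn <;>
    refine ⟨σc, τc, hl, ?_⟩ <;> rintro σ τ h rfl rfl <;>
    rw [← range_sumElim_coe hb.bijective.surjective]
  · exact h.bandQuadrics_eq_image k (hs.glue h) (by rw [glue_coe, hlast])
  · exact h.mobiusQuadrics_eq_image k (hs.glue h) (by rw [glue_coe, hlast])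

theorem exists_isLadder_of_isComponentQuadrics
    {S : G.ConnectedComponent → Set (MvPolynomial G.edgeSet k)}
    (hS : ∀ c, IsComponentQuadrics k c (S c)) :
    ∃ (σ τ : V → V) (h : IsLadder G σ τ), ⋃ c, S c = Set.range (h.quadric k) := by
  choose σ τ hl hSc using fun c => (hS c).exists_isLadder
  refine ⟨_, _, isLadder_glue hl, ?_⟩
  rw [Set.iUnion_congr fun c => hSc c (isLadder_glue hl) rfl rfl, ← Set.image_iUnion,
    SimpleGraph.iUnion_connectedComponentSupp, Set.image_univ]

theorem exists_isComponentQuadrics (k : Type*) [Field k]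
    (h : IsOddBand c.toSimpleGraph ∨ IsEvenMobiusBand c.toSimpleGraph) :
    ∃ S : Set (MvPolynomial G.edgeSet k), IsComponentQuadrics k c S := by
  rcases h with ⟨n, a, b, h⟩ | ⟨n, a, b, h⟩
  · exact ⟨_, n, a, b, .inl ⟨h.1, h.2, rfl⟩⟩
  · exact ⟨_, n, a, b, .inr ⟨h.1, h.2, rfl⟩⟩

end Components

section Cubic

variable (k : Type*) [Field k] {V : Type*} [Fintype V] {G : SimpleGraph V} [DecidableRel G.Adj]
  (hG : G.IsRegularOfDegree 3)

include hG

theorem IsLadder.isMinimalGeneratingSet_image {σ τ : V → V} (h : IsLadder G σ τ) {n : ℕ}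
    {a b : Fin (n + 1) → V} (hbij : Function.Bijective (Sum.elim a b)) :
    IsMinimalGeneratingSet (graphIdeal k G) (h.quadric k '' Set.range (Sum.elim a b)) ∧
      (∀ f ∈ h.quadric k '' Set.range (Sum.elim a b), f.IsHomogeneous 2) ∧
      (h.quadric k '' Set.range (Sum.elim a b)).encard = ((n + 1 : ℕ) : ℕ∞) := by
  obtain ⟨hmin, htwo, -⟩ := h.isMinimalGeneratingSet hG k
  have hcard : Fintype.card V = (n + 1) + (n + 1) := by
    rw [← Fintype.card_of_bijective hbij, Fintype.card_sum, Fintype.card_fin]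
  rw [hbij.surjective.range_eq, Set.image_univ]
  refine ⟨hmin, Set.forall_mem_range.2 (h.quadric_isHomogeneous k), ?_⟩
  rw [← (Set.finite_range _).cast_ncard_eq]
  exact congrArg _ (by omega)

theorem IsBand.isMinimalGeneratingSet {n : ℕ} {a b : Fin (n + 1) → V} (h : IsBand G a b)
    (hn : Odd (n + 1)) :
    IsMinimalGeneratingSet (graphIdeal k G) (bandQuadrics k G a b) ∧
      (∀ f ∈ bandQuadrics k G a b, f.IsHomogeneous 2) ∧
      (bandQuadrics k G a b).encard = ((n + 1 : ℕ) : ℕ∞) := by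
  obtain ⟨σ, τ, hl, hs, hlast⟩ := h.exists_isLadder hn
  rw [hl.bandQuadrics_eq_image k hs hlast]
  exact hl.isMinimalGeneratingSet_image k hG h.bijective

theorem IsMobiusBand.isMinimalGeneratingSet {n : ℕ} {a b : Fin (n + 1) → V}
    (h : IsMobiusBand G a b) (hn : Even (n + 1)) :
    IsMinimalGeneratingSet (graphIdeal k G) (mobiusQuadrics k G a b) ∧
      (∀ f ∈ mobiusQuadrics k G a b, f.IsHomogeneous 2) ∧
      (mobiusQuadrics k G a b).encard = ((n + 1 : ℕ) : ℕ∞) := by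
  obtain ⟨σ, τ, hl, hs, hlast⟩ := h.exists_isLadder hn
  rw [hl.mobiusQuadrics_eq_image k hs hlast]
  exact hl.isMinimalGeneratingSet_image k hG h.bijective

end Cubic

end ToricGraph

theorem mainTheorem6 (k : Type*) [Field k] {V : Type*} [Fintype V]
    (G : SimpleGraph V) [DecidableRel G.Adj] (hG : G.IsRegularOfDegree 3) :
    -- the characterization
    (ToricGraph.IsCompleteIntersection (ToricGraph.graphIdeal k G) ↔
      ∀ c : G.ConnectedComponent,
        ToricGraph.IsOddBand c.toSimpleGraph ∨ ToricGraph.IsEvenMobiusBand c.toSimpleGraph) ∧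
    -- the generators when `G` is an odd band
    (∀ (n : ℕ) (a b : Fin (n + 1) → V), Odd (n + 1) → ToricGraph.IsBand G a b →
      ToricGraph.IsMinimalGeneratingSet (ToricGraph.graphIdeal k G)
          (ToricGraph.bandQuadrics k G a b) ∧
        (∀ f ∈ ToricGraph.bandQuadrics k G a b, f.IsHomogeneous 2) ∧
        (ToricGraph.bandQuadrics k G a b).encard = ((n + 1 : ℕ) : ℕ∞)) ∧
    -- the generators when `G` is an even Möbius band
    (∀ (n : ℕ) (a b : Fin (n + 1) → V), Even (n + 1) → ToricGraph.IsMobiusBand G a b →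
      ToricGraph.IsMinimalGeneratingSet (ToricGraph.graphIdeal k G)
          (ToricGraph.mobiusQuadrics k G a b) ∧
        (∀ f ∈ ToricGraph.mobiusQuadrics k G a b, f.IsHomogeneous 2) ∧
        (ToricGraph.mobiusQuadrics k G a b).encard = ((n + 1 : ℕ) : ℕ∞)) ∧
    -- the generators in general: the union over the connected components
    (∀ S : G.ConnectedComponent → Set (MvPolynomial G.edgeSet k),
      (∀ c, ToricGraph.IsComponentQuadrics k c (S c)) →
        ToricGraph.IsMinimalGeneratingSet (ToricGraph.graphIdeal k G) (⋃ c, S c) ∧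
          ∀ f ∈ ⋃ c, S c, f.IsHomogeneous 2) := by
  refine ⟨⟨fun hci c => ?_, fun h => ?_⟩, fun n a b hn h => h.isMinimalGeneratingSet k hG hn,
    fun n a b hn h => h.isMinimalGeneratingSet k hG hn, fun S hS => ?_⟩
  · exact ToricGraph.isOddBand_or_isEvenMobiusBand_of_isCompleteIntersection c hG hci
  · choose S hS using fun c => ToricGraph.exists_isComponentQuadrics k (h c)
    obtain ⟨σ, τ, hladder, -⟩ := ToricGraph.exists_isLadder_of_isComponentQuadrics hS
    exact (hladder.isMinimalGeneratingSet hG k).2.2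
  · obtain ⟨σ, τ, hladder, hQ⟩ := ToricGraph.exists_isLadder_of_isComponentQuadrics hS
    rw [hQ]
    exact ⟨(hladder.isMinimalGeneratingSet hG k).1,
      Set.forall_mem_range.2 (hladder.quadric_isHomogeneous k)⟩
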